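/- **Setting.** Consider the stochastic descriptor system $E x_{k+1} = A x_k + B u_k + w_k$, $y_k = C x_k + D u_k + v_k$ $(k \ge 0)$, with $x_k\in\mathbb R^n$, deterministic input $u_k\in\mathbb R^m$, output $y_k\in\mathbb R^p$, mutually independent Gaussian white noises $w_k\sim\mathcal N(0,Q)$, $v_k\sim\mathcal N(0,R)$, $Q\succeq 0$, $R\succ 0$, and regular pencil $zE-A$. Let $P,T$ be nonsingular with $PET=\mathrm{diag}(I_{n_s},N)$, $PAT=\mathrm{diag}(J,I_{n_f})$, $N$ nilpotent of index $s$; write $PB=[B_s;B_f]$, $CT=[C_s,\,C_f]$, $T^{-1}x_k=[x_k^s;x_k^f]$. Let $r_w=\operatorname{rank}(PQP^\top)$ and $PQP^\top=LL^\top$ with $L=[L_s;L_f]\in\mathbb R^{n\times r_w}$. The initial slow state $x_0^s$ is random, with a distribution $\mu_0$, and independent of the noises. Put $d_k = Du_k - C_f\sum_{i=0}^{s-1}N^iB_fu_{k+i}$. Let $\varepsilon_k\sim\mathcal N(0,I_{r_w})$ be white noise independent of $v$, $\eta_k=[\varepsilon_k;\dots;\varepsilon_{k+s}]$, $\xi_k=[x_k^s;\eta_k]$.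 Let $A_\eta$ be the block upward shift, $B_\eta=[0;\dots;0;I_{r_w}]$, $S_0=[I_{r_w},0,\dots,0]$, $M=[I,N,\dots,N^s]$, $S_f=I_{s+1}\otimes L_f$. The augmented system is $$\xi_{k+1}=A_\xi\xi_k+B_\xi u_k+G_\xi\varepsilon_{k+s+1},\qquad \tilde y_k=C_\xi\xi_k+v_k,$$ $$A_\xi=\begin{bmatrix}J&L_sS_0\\0&A_\eta\end{bmatrix},\quad B_\xi=\begin{bmatrix}B_s\\0\end{bmatrix},\quad G_\xi=\begin{bmatrix}0\\B_\eta\end{bmatrix},\quad C_\xi=\begin{bmatrix}C_s&-C_fMS_f\end{bmatrix},$$ with output $y_k=\tilde y_k+d_k$. A steady-state error covariance is a matrix $P_\infty\succeq0$ with $P_\infty=A_\xi P_\infty A_\xi^\top-A_\xi P_\infty C_\xi^\top(C_\xi P_\infty C_\xi^\top+R)^{-1}C_\xi P_\infty A_\xi^\top+G_\xi G_\xi^\top$. The corresponding steady-state Kalman filter is $\hat\xi_{k+1|k}=A_\xi\hat\xi_{k|k-1}+B_\xi u_k+K_p(\tilde y_k-C_\xi\hat\xi_{k|k-1})$ with $K_p=A_\xi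 P_\infty C_\xi^\top(C_\xi P_\infty C_\xi^\top+R)^{-1}$ and $\hat y_{k|k-1}=C_\xi\hat\xi_{k|k-1}+d_k$. It operates in steady state: for some (possibly trivial) $\sigma$-algebra $\mathcal F$ of information available before time $0$, with $(\mathcal F,\xi_0)$ independent of $(\varepsilon_{k+s+1},v_k)_{k\ge0}$, the vector $\hat\xi_{0|-1}$ is $\mathcal F$-measurable and $\xi_0-\hat\xi_{0|-1}\sim\mathcal N(0,P_\infty)$ is independent of $\mathcal F$. **Theorem 2 (Stochastic Equivalence).** 1. (Causality.) With $\xi_0=[x_0^s;\varepsilon_0;\dots;\varepsilon_s]$, the buffer part of $\xi_k$ is $[\varepsilon_k;\dots;\varepsilon_{k+s}]$ for all $k$, and $\varepsilon_{k+s+1}$ is independent of $(\xi_0,\dots,\xi_k,(v_j)_{j\ge0})$. 2. (Innovations.) A steady-state error covariance $P_\infty$ exists if $(A_\xi,C_\xi)$ is detectable. For every steady-state error covariance $P_\infty$ and its filter in steady state, for any initial state $\xi_0$ as above (whether or not its buffer part is $[\varepsilon_0;\dots;\varepsilon_s]$), the innovations $e_k=y_k-\hat y_{k|k-1}$ are Gaussian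 white noise (independent, $\mathcal N(0,\Sigma_e)$) with $\Sigma_e=C_\xi P_\infty C_\xi^\top+R$; the error $\xi_k-\hat\xi_{k|k-1}$ has distribution $\mathcal N(0,P_\infty)$ for all $k$; and, if $\hat\xi_{0|-1}$ is integrable, $\hat y_{k|k-1}=\mathbb E[y_k\mid\mathcal F,y_0,\dots,y_{k-1}]$ almost surely. 3. (Stochastic equivalence.) For the same input sequence and the same $\mu_0$, the output process $(y_k)_{k\ge0}$ of the descriptor system and the output process $(\tilde y_k+d_k)_{k\ge0}$ of the augmented system started at $\xi_0=[x_0^s;\varepsilon_0;\dots;\varepsilon_s]$ have the same distribution. Moreover, for every process of the latter kind the descriptor system driven by $w_k=P^{-1}L\varepsilon_k$ and the same $v_k$ has a solution with the same slow state and the output $y_k=\tilde y_k+d_k$. -/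

import Mathlib

open MeasureTheory ProbabilityTheory
open scoped Matrix Kronecker

noncomputable section

/-! ### Gaussian white noise -/

/-- The centred Gaussian distribution `N(0, S)` on `ι → ℝ` (meant for positive semidefinite `S`). -/
def centredGaussian {ι : Type*} [Fintype ι] [DecidableEq ι] (S : Matrix ι ι ℝ) :
    Measure (ι → ℝ) :=
  (multivariateGaussian (0 : EuclideanSpace ℝ ι) S).map WithLp.ofLp

/-- `X 0, X 1, …` are independent random vectors, each with distribution `N(0, S)`. -/
structure IsGaussianWhiteNoise {ι : Type*} [Fintype ι] [DecidableEq ι] {Ω : Type*}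
    [MeasurableSpace Ω] (S : Matrix ι ι ℝ) (X : ℕ → Ω → ι → ℝ) (μ : Measure Ω) : Prop where
  measurable : ∀ k, Measurable (X k)
  hasLaw : ∀ k, HasLaw (X k) (centredGaussian S) μ
  indep : iIndepFun X μ

/-! ### Stochastic descriptor systems and their quasi-Weierstrass form -/

/-- The data of a stochastic descriptor system
`E x (k+1) = A x k + B u k + w k`, `y k = C x k + D u k + v k` with noise covariances `Q ⪰ 0`
(process) and `R ≻ 0` (measurement) and a regular matrix pencil `z E - A`. -/
structure DescriptorSystem (n m p : ℕ) where
  E : Matrix (Fin n) (Fin n) ℝ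
  A : Matrix (Fin n) (Fin n) ℝ
  B : Matrix (Fin n) (Fin m) ℝ
  C : Matrix (Fin p) (Fin n) ℝ
  D : Matrix (Fin p) (Fin m) ℝ
  Q : Matrix (Fin n) (Fin n) ℝ
  R : Matrix (Fin p) (Fin p) ℝ
  posSemidef_Q : Q.PosSemidef
  posDef_R : R.PosDef
  regular : ∃ z : ℂ, (z • E.map Complex.ofReal - A.map Complex.ofReal).det ≠ 0

/-- Splitting of the `n` state coordinates into the first `ns` (slow) and the last `nf` (fast). -/
def blockEquiv {n ns nf : ℕ} (h : ns + nf = n) : Fin ns ⊕ Fin nf ≃ Fin n :=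
  finSumFinEquiv.trans (finCongr h)

/-- A quasi-Weierstrass form of `S` with slow dimension `ns`, fast dimension `nf` and nilpotency
index `s`: nonsingular `P`, `T` with `P E T = diag(I, N)`, `P A T = diag(J, I)` and `N` nilpotent of
index `s`; together with a full-rank factor `L` of the transformed noise covariance `P Q Pᵀ`, whose
rank is `rw`. -/
structure QuasiWeierstrass {n m p : ℕ} (S : DescriptorSystem n m p) (ns nf s rw : ℕ) where
  P : Matrix (Fin n) (Fin n) ℝ
  T : Matrix (Fin n) (Fin n) ℝ
  J : Matrix (Fin ns) (Fin ns) ℝ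
  N : Matrix (Fin nf) (Fin nf) ℝ
  L : Matrix (Fin n) (Fin rw) ℝ
  dim : ns + nf = n
  isUnit_P : IsUnit P.det
  isUnit_T : IsUnit T.det
  transform_E : P * S.E * T =
    (Matrix.fromBlocks 1 0 0 N).reindex (blockEquiv dim) (blockEquiv dim)
  transform_A : P * S.A * T =
    (Matrix.fromBlocks J 0 0 1).reindex (blockEquiv dim) (blockEquiv dim)
  isNilpotent_N : IsNilpotent N
  index_N : nilpotencyClass N = s
  rank_noise : (P * S.Q * Pᵀ).rank = rw
  factor_noise : L * Lᵀ = P * S.Q * Pᵀ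

namespace QuasiWeierstrass

variable {n m p ns nf s rw : ℕ} {S : DescriptorSystem n m p} (W : QuasiWeierstrass S ns nf s rw)

/-- Position of the `i`-th slow coordinate. -/
def slowIdx (i : Fin ns) : Fin n := blockEquiv W.dim (Sum.inl i)

/-- Position of the `i`-th fast coordinate. -/
def fastIdx (i : Fin nf) : Fin n := blockEquiv W.dim (Sum.inr i)

def Bs : Matrix (Fin ns) (Fin m) ℝ := (W.P * S.B).submatrix W.slowIdx id
def Bf : Matrix (Fin nf) (Fin m) ℝ := (W.P * S.B).submatrix W.fastIdx id
def Cs : Matrix (Fin p) (Fin ns) ℝ := (S.C * W.T).submatrix id W.slowIdx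
def Cf : Matrix (Fin p) (Fin nf) ℝ := (S.C * W.T).submatrix id W.fastIdx
def Ls : Matrix (Fin ns) (Fin rw) ℝ := W.L.submatrix W.slowIdx id
def Lf : Matrix (Fin nf) (Fin rw) ℝ := W.L.submatrix W.fastIdx id

/-- The slow part of a descriptor state `x`, i.e. the first `ns` coordinates of `T⁻¹ x`. -/
def slowState (x : Fin n → ℝ) : Fin ns → ℝ := fun i => (W.T⁻¹ *ᵥ x) (W.slowIdx i)

/-- The deterministic part `d k = D u k - C_f ∑_{i<s} N^i B_f u (k+i)` of the output. -/
def feedthrough (u : ℕ → Fin m → ℝ) (k : ℕ) : Fin p → ℝ :=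
  S.D *ᵥ u k - W.Cf *ᵥ ∑ i ∈ Finset.range s, (W.N ^ i * W.Bf) *ᵥ u (k + i)

/-! ### The augmented system -/

/-- Coordinates of the noise buffer `η = [ε_k; …; ε_{k+s}]`. -/
abbrev BufIdx (_ : QuasiWeierstrass S ns nf s rw) : Type := Fin (s + 1) × Fin rw

/-- Coordinates of the augmented state `ξ = [x^s; η]`. -/
abbrev AugIdx (W : QuasiWeierstrass S ns nf s rw) : Type := Fin ns ⊕ W.BufIdx

/-- Block upward shift: block `i` of `Aη η` is block `i + 1` of `η`, the last block is `0`. -/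
def Aη : Matrix W.BufIdx W.BufIdx ℝ :=
  Matrix.of fun i j => if j.1.val = i.1.val + 1 ∧ j.2 = i.2 then 1 else 0

/-- `[0; …; 0; I]`. -/
def Bη : Matrix W.BufIdx (Fin rw) ℝ :=
  Matrix.of fun i a => if i.1 = Fin.last s ∧ i.2 = a then 1 else 0

/-- `[I, 0, …, 0]`. -/
def S₀ : Matrix (Fin rw) W.BufIdx ℝ :=
  Matrix.of fun a j => if j.1 = 0 ∧ j.2 = a then 1 else 0

/-- `[I, N, …, N^s]`. -/
def M : Matrix (Fin nf) (Fin (s + 1) × Fin nf) ℝ :=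
  Matrix.of fun a j => (W.N ^ j.1.val) a j.2

/-- `I_{s+1} ⊗ L_f`. -/
def Sf : Matrix (Fin (s + 1) × Fin nf) W.BufIdx ℝ :=
  (1 : Matrix (Fin (s + 1)) (Fin (s + 1)) ℝ) ⊗ₖ W.Lf

def Aξ : Matrix W.AugIdx W.AugIdx ℝ := Matrix.fromBlocks W.J (W.Ls * W.S₀) 0 W.Aη
def Bξ : Matrix W.AugIdx (Fin m) ℝ := Matrix.fromRows W.Bs 0
def Gξ : Matrix W.AugIdx (Fin rw) ℝ := Matrix.fromRows 0 W.Bη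
def Cξ : Matrix (Fin p) W.AugIdx ℝ := Matrix.fromCols W.Cs (-(W.Cf * W.M * W.Sf))

end QuasiWeierstrass

/-! ### The steady-state Kalman filter -/

section Kalman

variable {a g p : Type*} [Fintype a] [Fintype g] [Fintype p] [DecidableEq a] [DecidableEq p]

/-- `P` is a steady-state prediction error covariance of the Kalman filter for
`ξ (k+1) = A ξ k + G ε k`, `y k = C ξ k + v k` with `ε k ∼ N(0, I)` and `v k ∼ N(0, R)`:
a positive semidefinite fixed point of the Riccati recursion. -/
structure IsSteadyStateCovariance (A : Matrix a a ℝ) (G : Matrix a g ℝ) (C : Matrix p a ℝ)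
    (R : Matrix p p ℝ) (P : Matrix a a ℝ) : Prop where
  posSemidef : P.PosSemidef
  riccati : P = A * P * Aᵀ - A * P * Cᵀ * (C * P * Cᵀ + R)⁻¹ * (C * P * Aᵀ) + G * Gᵀ

/-- The (predictor form) Kalman gain. -/
def kalmanGain (A : Matrix a a ℝ) (C : Matrix p a ℝ) (R : Matrix p p ℝ) (P : Matrix a a ℝ) :
    Matrix a p ℝ :=
  A * P * Cᵀ * (C * P * Cᵀ + R)⁻¹

/-- `(A, C)` is detectable: some output injection `A - K C` is Schur stable. -/
def IsDetectable (A : Matrix a a ℝ) (C : Matrix p a ℝ) : Prop :=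
  ∃ K : Matrix a p ℝ, ∀ z ∈ spectrum ℂ ((A - K * C).map Complex.ofReal), ‖z‖ < 1

end Kalman

/-! ### Realizations on a probability space -/

section Processes

variable {n m p ns nf s rw : ℕ} {S : DescriptorSystem n m p}

/-- `x`, `y` are a state and an output process of the descriptor system `S` for the input sequence
`u` and the noises `w`, `v`. The slow part of the initial state has distribution `μ₀` and is
independent of the noises (the fast part is determined by the equations). -/
structure IsDescriptorProcess (W : QuasiWeierstrass S ns nf s rw) (u : ℕ → Fin m → ℝ)
    (μ₀ : Measure (Fin ns → ℝ)) {Ω : Type*} [MeasurableSpace Ω] (μ : Measure Ω)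
    (x w : ℕ → Ω → Fin n → ℝ) (v y : ℕ → Ω → Fin p → ℝ) : Prop where
  white_w : IsGaussianWhiteNoise S.Q w μ
  white_v : IsGaussianWhiteNoise S.R v μ
  indep_noise : IndepFun (fun ω k => w k ω) (fun ω k => v k ω) μ
  measurable_x : ∀ k, Measurable (x k)
  law_init : HasLaw (fun ω => W.slowState (x 0 ω)) μ₀ μ
  indep_init : IndepFun (fun ω => W.slowState (x 0 ω))
    (fun ω => ((fun k => w k ω), (fun k => v k ω))) μ
  state_eq : ∀ k ω, S.E *ᵥ x (k + 1) ω = S.A *ᵥ x k ω + S.B *ᵥ u k + w k ω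
  output_eq : ∀ k ω, y k ω = S.C *ᵥ x k ω + S.D *ᵥ u k + v k ω

/-- `ξ`, `ỹ` are a state and an output process of the augmented system
`ξ (k+1) = Aξ ξ k + Bξ u k + Gξ ε (k+s+1)`, `ỹ k = Cξ ξ k + v k`, for the input sequence `u` and
independent white noises `ε ∼ N(0, I)`, `v ∼ N(0, R)`. Nothing is said on the initial state. -/
structure IsAugmentedProcess (W : QuasiWeierstrass S ns nf s rw) (u : ℕ → Fin m → ℝ)
    {Ω : Type*} [MeasurableSpace Ω] (μ : Measure Ω)
    (ε : ℕ → Ω → Fin rw → ℝ) (v : ℕ → Ω → Fin p → ℝ)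
    (ξ : ℕ → Ω → W.AugIdx → ℝ) (ytil : ℕ → Ω → Fin p → ℝ) : Prop where
  white_ε : IsGaussianWhiteNoise (1 : Matrix (Fin rw) (Fin rw) ℝ) ε μ
  white_v : IsGaussianWhiteNoise S.R v μ
  indep_noise : IndepFun (fun ω k => ε k ω) (fun ω k => v k ω) μ
  measurable_init : Measurable (ξ 0)
  state_eq : ∀ k ω, ξ (k + 1) ω = W.Aξ *ᵥ ξ k ω + W.Bξ *ᵥ u k + W.Gξ *ᵥ ε (k + s + 1) ω
  output_eq : ∀ k ω, ytil k ω = W.Cξ *ᵥ ξ k ω + v k ω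

/-- The initial augmented state is `[x^s; ε_0; …; ε_s]`, where the initial slow state `x^s` has
distribution `μ₀` and is independent of the noises. -/
structure HasBufferedInit (W : QuasiWeierstrass S ns nf s rw) (μ₀ : Measure (Fin ns → ℝ))
    {Ω : Type*} [MeasurableSpace Ω] (μ : Measure Ω)
    (ε : ℕ → Ω → Fin rw → ℝ) (v : ℕ → Ω → Fin p → ℝ) (ξ : ℕ → Ω → W.AugIdx → ℝ) : Prop where
  buffer_init : ∀ ω i b, ξ 0 ω (Sum.inr (i, b)) = ε i.val ω b
  law_init : HasLaw (fun ω i => ξ 0 ω (Sum.inl i)) μ₀ μ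
  indep_init : IndepFun (fun ω i => ξ 0 ω (Sum.inl i))
    (fun ω => ((fun k => ε k ω), (fun k => v k ω))) μ

/-- `ξhat k` is the one-step prediction of `ξ k` by the Kalman filter of the augmented system in
steady state with error covariance `Pinf`.  `F` is the information available before time `0`
(possibly trivial); it is independent, jointly with `ξ 0`, of the noise that enters afterwards.
Steady state means that, given `F`, the initial state has distribution `N(ξhat 0, Pinf)`. -/
structure IsSteadyStateFilter (W : QuasiWeierstrass S ns nf s rw) (u : ℕ → Fin m → ℝ)
    {Ω : Type*} (F : MeasurableSpace Ω) [mΩ : MeasurableSpace Ω] (μ : Measure Ω)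
    (Pinf : Matrix W.AugIdx W.AugIdx ℝ)
    (ε : ℕ → Ω → Fin rw → ℝ) (v : ℕ → Ω → Fin p → ℝ)
    (ξ : ℕ → Ω → W.AugIdx → ℝ) (ytil : ℕ → Ω → Fin p → ℝ)
    (ξhat : ℕ → Ω → W.AugIdx → ℝ) : Prop where
  le : F ≤ mΩ
  steady : IsSteadyStateCovariance W.Aξ W.Gξ W.Cξ S.R Pinf
  measurable_hat : Measurable[F] (ξhat 0)
  indep_noise : Indep (F ⊔ MeasurableSpace.comap (ξ 0) inferInstance)
    (MeasurableSpace.comap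
      (fun ω => ((fun k => ε (k + s + 1) ω), (fun k => v k ω))) inferInstance) μ
  law_error : HasLaw (fun ω => ξ 0 ω - ξhat 0 ω) (centredGaussian Pinf) μ
  indep_error : Indep F
    (MeasurableSpace.comap (fun ω => ξ 0 ω - ξhat 0 ω) inferInstance) μ
  update : ∀ k ω, ξhat (k + 1) ω = W.Aξ *ᵥ ξhat k ω + W.Bξ *ᵥ u k +
    kalmanGain W.Aξ W.Cξ S.R Pinf *ᵥ (ytil k ω - W.Cξ *ᵥ ξhat k ω)

end Processes

end

/-!
# Stochastic equivalence of a descriptor system and its augmented system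

**Gaussian and independence tools.** Centred Gaussian vectors are identified by their
characteristic functions (`hasLaw_centredGaussian_iff`), so linear images and stacks of independent
Gaussian vectors are Gaussian with the expected covariance, and a block diagonal covariance means
independent blocks. Independence is handled through `σ`-algebras: if `m₁` is independent of `m₂` and
`m₃` of `m₁ ⊔ m₂`, then `m₁` is independent of `m₂ ⊔ m₃` (`indep_sup_of_indep_sup`).

**Existence of a steady-state covariance.** Completing the square shows that the Riccati map is the
minimum over all gains `K` of the covariance updates `gainUpdate K`, which are monotone and affine.
Hence the Riccati recursion started at `0` increases in the Loewner order. For a stabilizing gain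
`K` it stays below the solution `∑ Fⁱ V (Fᵀ)ⁱ` of the Lyapunov equation with `F = A - K C`, so it
converges, and the limit is a fixed point.

**Innovations.** Let `X` be the prediction error, `e = C X + v` the innovation and
`X' = A X + G ε - K e` the next error. With the Kalman gain the covariance of the Gaussian vector
`(X', e)` is `diag(P, C P Cᵀ + R)` (`innovation_covariance`), so `X'` is again `N(0, P)` and
independent of `e`. By induction the error is independent of the information `F, y₀, …, y_{k-1}`,
because `y_k` is `e_k` plus a quantity that this information determines. Therefore each innovation
is independent of the past, and `y_k = ŷ_k + e_k` has conditional expectation `ŷ_k`.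

**Equivalence.** In the quasi-Weierstrass coordinates the descriptor equation decouples
(`descriptor_step_iff`). As `N` is nilpotent, the fast part is the finite sum
`-∑ Nⁱ (B_f u_{k+i} + w^f_{k+i})` (`fast_solution_iff`). Both outputs are thus the image, under the
same measurable map `outputMap`, of an initial slow state, a transformed process noise (`P w` or
`L ε`) and the measurement noise. These triples are equal in law since `P Q Pᵀ = L Lᵀ`.
-/

noncomputable section

/-! ### Centred Gaussian vectors -/

section Gaussian

@[fun_prop]
lemma measurable_mulVec {ι κ : Type*} [Fintype ι] [Countable κ] (M : Matrix κ ι ℝ) :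
    Measurable fun x : ι → ℝ => M *ᵥ x :=
  (Continuous.matrix_mulVec continuous_const continuous_id).measurable

@[fun_prop]
lemma measurable_sumElim {ι κ : Type*} :
    Measurable fun z : (ι → ℝ) × (κ → ℝ) => (Sum.elim z.1 z.2 : ι ⊕ κ → ℝ) := by
  refine measurable_pi_iff.2 ?_
  rintro (i | i)
  · exact (measurable_pi_apply i).comp measurable_fst
  · exact (measurable_pi_apply i).comp measurable_snd

lemma posSemidef_fromBlocks_diag {ι κ : Type*} [Fintype ι] [Fintype κ] {S : Matrix ι ι ℝ}
    {S' : Matrix κ κ ℝ} (hS : S.PosSemidef) (hS' : S'.PosSemidef) :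
    (Matrix.fromBlocks S 0 0 S').PosSemidef := by
  refine Matrix.PosSemidef.of_dotProduct_mulVec_nonneg ?_ fun x => ?_
  · exact Matrix.IsHermitian.fromBlocks hS.1 (by simp) hS'.1
  · rw [← Sum.elim_comp_inl_inr x, Matrix.fromBlocks_mulVec]
    simp only [Matrix.zero_mulVec, add_zero, zero_add]
    have h1 := hS.dotProduct_mulVec_nonneg (x ∘ Sum.inl)
    have h2 := hS'.dotProduct_mulVec_nonneg (x ∘ Sum.inr)
    simp [dotProduct] at h1 h2 ⊢
    linarith

variable {ι κ Ω : Type*} [Fintype ι] [DecidableEq ι] [Fintype κ] [DecidableEq κ]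
  [MeasurableSpace Ω] {μ : Measure Ω}

instance isProbabilityMeasure_centredGaussian (S : Matrix ι ι ℝ) :
    IsProbabilityMeasure (centredGaussian S) :=
  Measure.isProbabilityMeasure_map (by fun_prop)

lemma charFun_map_toLp {ι : Type*} [Fintype ι] {X : Ω → ι → ℝ} (hX : AEMeasurable X μ) (t : ι → ℝ) :
    charFun ((μ.map X).map (WithLp.toLp 2)) (WithLp.toLp 2 t) =
      ∫ ω, Complex.exp (((t ⬝ᵥ X ω : ℝ) : ℂ) * Complex.I) ∂μ := by
  rw [charFun_apply, integral_map (by fun_prop) (by fun_prop), integral_map hX (by fun_prop)]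
  rfl

/-- Lévy's uniqueness theorem, for the centred Gaussian distribution on `ι → ℝ`. -/
lemma hasLaw_centredGaussian_iff [IsProbabilityMeasure μ] {S : Matrix ι ι ℝ}
    (hS : S.PosSemidef) {X : Ω → ι → ℝ} (hX : AEMeasurable X μ) :
    HasLaw X (centredGaussian S) μ ↔ ∀ t : ι → ℝ,
      ∫ ω, Complex.exp (((t ⬝ᵥ X ω : ℝ) : ℂ) * Complex.I) ∂μ =
        Complex.exp (-((t ⬝ᵥ S *ᵥ t : ℝ) : ℂ) / 2) := by
  have hchar : ∀ t : ι → ℝ, charFun ((centredGaussian S).map (WithLp.toLp 2)) (WithLp.toLp 2 t) =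
      Complex.exp (-((t ⬝ᵥ S *ᵥ t : ℝ) : ℂ) / 2) := by
    intro t
    have : (centredGaussian S).map (WithLp.toLp 2) = multivariateGaussian 0 S := by
      rw [centredGaussian, Measure.map_map (by fun_prop) (by fun_prop)]
      exact Measure.map_id
    rw [this, charFun_multivariateGaussian hS]
    simp [neg_div]
  constructor
  · intro h t
    rw [← charFun_map_toLp hX, h.map_eq, hchar]
  · intro h
    refine ⟨hX, ?_⟩
    have := Measure.isProbabilityMeasure_map hX
    have hE : (μ.map X).map (WithLp.toLp 2) = (centredGaussian S).map (WithLp.toLp 2) := by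
      have := Measure.isProbabilityMeasure_map (μ := μ.map X) (f := WithLp.toLp 2) (by fun_prop)
      have := Measure.isProbabilityMeasure_map (μ := centredGaussian S) (f := WithLp.toLp 2)
        (by fun_prop)
      refine Measure.ext_of_charFun (funext fun t => ?_)
      have := charFun_map_toLp hX t.ofLp
      have h2 := hchar t.ofLp
      simp only [WithLp.toLp_ofLp] at this h2
      rw [this, h, h2]
    exact (MeasurableEquiv.toLp 2 (ι → ℝ)).map_measurableEquiv_injective hE

lemma hasLaw_mulVec_centredGaussian {S : Matrix ι ι ℝ} (hS : S.PosSemidef) {X : Ω → ι → ℝ}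
    (hX : HasLaw X (centredGaussian S) μ) (M : Matrix κ ι ℝ) :
    HasLaw (fun ω => M *ᵥ X ω) (centredGaussian (M * S * Mᵀ)) μ := by
  have := hX.isProbabilityMeasure
  have hM : (M * S * Mᵀ).PosSemidef := by
    simpa using hS.mul_mul_conjTranspose_same M
  rw [hasLaw_centredGaussian_iff hM (by fun_prop)]
  intro t
  have h := (hasLaw_centredGaussian_iff hS hX.aemeasurable).1 hX (Mᵀ *ᵥ t)
  have h2 : (Mᵀ *ᵥ t) ⬝ᵥ S *ᵥ (Mᵀ *ᵥ t) = t ⬝ᵥ (M * S * Mᵀ) *ᵥ t := by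
    rw [← Matrix.mulVec_mulVec, ← Matrix.mulVec_mulVec, Matrix.dotProduct_mulVec t M,
      Matrix.mulVec_transpose]
  rw [h2] at h
  rw [← h]
  simp only [Matrix.dotProduct_mulVec, Matrix.mulVec_transpose]

/-- Stacking independent centred Gaussian vectors. -/
lemma hasLaw_sumElim_centredGaussian {S : Matrix ι ι ℝ} {S' : Matrix κ κ ℝ} (hS : S.PosSemidef)
    (hS' : S'.PosSemidef) {X : Ω → ι → ℝ} {Y : Ω → κ → ℝ}
    (hX : HasLaw X (centredGaussian S) μ) (hY : HasLaw Y (centredGaussian S') μ)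
    (h : IndepFun X Y μ) :
    HasLaw (fun ω => Sum.elim (X ω) (Y ω)) (centredGaussian (Matrix.fromBlocks S 0 0 S')) μ := by
  have := hX.isProbabilityMeasure
  have hXm := hX.aemeasurable
  have hYm := hY.aemeasurable
  have hm : AEMeasurable (fun ω => Sum.elim (X ω) (Y ω)) μ :=
    measurable_sumElim.comp_aemeasurable (hXm.prodMk hYm)
  rw [hasLaw_centredGaussian_iff (posSemidef_fromBlocks_diag hS hS') hm]
  intro t
  have key : ∀ ω, Complex.exp (((t ⬝ᵥ Sum.elim (X ω) (Y ω) : ℝ) : ℂ) * Complex.I) =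
      Complex.exp ((((t ∘ Sum.inl) ⬝ᵥ X ω : ℝ) : ℂ) * Complex.I) *
      Complex.exp ((((t ∘ Sum.inr) ⬝ᵥ Y ω : ℝ) : ℂ) * Complex.I) := by
    intro ω
    rw [← Complex.exp_add, ← add_mul, ← Complex.ofReal_add]
    simp [dotProduct]
  simp_rw [key]
  have hi : IndepFun (fun ω => Complex.exp ((((t ∘ Sum.inl) ⬝ᵥ X ω : ℝ) : ℂ) * Complex.I))
      (fun ω => Complex.exp ((((t ∘ Sum.inr) ⬝ᵥ Y ω : ℝ) : ℂ) * Complex.I)) μ :=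
    h.comp (φ := fun x => Complex.exp ((((t ∘ Sum.inl) ⬝ᵥ x : ℝ) : ℂ) * Complex.I))
      (ψ := fun x => Complex.exp ((((t ∘ Sum.inr) ⬝ᵥ x : ℝ) : ℂ) * Complex.I))
      (by simp only [dotProduct]; fun_prop) (by simp only [dotProduct]; fun_prop)
  rw [hi.integral_fun_mul_eq_mul_integral
    (by simp only [dotProduct]; exact AEMeasurable.aestronglyMeasurable (by fun_prop))
    (by simp only [dotProduct]; exact AEMeasurable.aestronglyMeasurable (by fun_prop)),
    (hasLaw_centredGaussian_iff hS hXm).1 hX, (hasLaw_centredGaussian_iff hS' hYm).1 hY,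
    ← Complex.exp_add]
  congr 1
  conv_rhs => rw [← Sum.elim_comp_inl_inr t, Matrix.fromBlocks_mulVec]
  simp [dotProduct]
  ring

/-- Uncorrelated blocks of a centred Gaussian vector are independent. -/
lemma indepFun_of_hasLaw_sumElim_centredGaussian {S : Matrix ι ι ℝ} {S' : Matrix κ κ ℝ}
    (hS : S.PosSemidef) (hS' : S'.PosSemidef) {X : Ω → ι → ℝ} {Y : Ω → κ → ℝ}
    (h : HasLaw (fun ω => Sum.elim (X ω) (Y ω)) (centredGaussian (Matrix.fromBlocks S 0 0 S')) μ) :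
    HasLaw X (centredGaussian S) μ ∧ HasLaw Y (centredGaussian S') μ ∧ IndepFun X Y μ := by
  have := h.isProbabilityMeasure
  have hb := posSemidef_fromBlocks_diag hS hS'
  have hX : HasLaw X (centredGaussian S) μ := by
    have := hasLaw_mulVec_centredGaussian hb h (Matrix.fromCols (1 : Matrix ι ι ℝ) 0)
    simpa [Matrix.fromCols_mul_fromBlocks, Matrix.fromCols_mulVec_sumElim,
      Matrix.transpose_fromCols, Matrix.fromCols_mul_fromRows] using this
  have hY : HasLaw Y (centredGaussian S') μ := by
    have := hasLaw_mulVec_centredGaussian hb h (Matrix.fromCols 0 (1 : Matrix κ κ ℝ))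
    simpa [Matrix.fromCols_mul_fromBlocks, Matrix.fromCols_mulVec_sumElim,
      Matrix.transpose_fromCols, Matrix.fromCols_mul_fromRows] using this
  refine ⟨hX, hY, (indepFun_iff_hasLaw_prodMk_prod hX hY).2
    ⟨hX.aemeasurable.prodMk hY.aemeasurable, ?_⟩⟩
  have hX' : HasLaw (fun z : (ι → ℝ) × (κ → ℝ) => z.1) (centredGaussian S)
      ((centredGaussian S).prod (centredGaussian S')) := ⟨by fun_prop, by simp⟩
  have hY' : HasLaw (fun z : (ι → ℝ) × (κ → ℝ) => z.2) (centredGaussian S')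
      ((centredGaussian S).prod (centredGaussian S')) := ⟨by fun_prop, by simp⟩
  have h' := hasLaw_sumElim_centredGaussian hS hS' hX' hY'
    (indepFun_prod (X := id) (Y := id) measurable_id measurable_id)
  let e := (MeasurableEquiv.sumPiEquivProdPi fun _ : ι ⊕ κ => ℝ).symm
  have he : ⇑e = fun z : (ι → ℝ) × (κ → ℝ) => (Sum.elim z.1 z.2 : ι ⊕ κ → ℝ) := by
    funext z i
    rcases i with i | i <;> rfl
  refine e.map_measurableEquiv_injective ?_
  rw [he, h'.map_eq, AEMeasurable.map_map_of_aemeasurable (by fun_prop)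
    (hX.aemeasurable.prodMk hY.aemeasurable)]
  exact h.map_eq

lemma centredGaussian_integrable_id (S : Matrix ι ι ℝ) :
    Integrable (fun x => x) (centredGaussian S) := by
  have h : Integrable (fun x : EuclideanSpace ℝ ι => WithLp.ofLp x) (multivariateGaussian 0 S) :=
    (PiLp.continuousLinearEquiv 2 ℝ fun _ : ι => ℝ).toContinuousLinearMap.integrable_comp
      IsGaussian.integrable_id
  exact (integrable_map_measure (by fun_prop) (by fun_prop)).2 h

lemma integral_id_centredGaussian (S : Matrix ι ι ℝ) : ∫ x, x ∂centredGaussian S = 0 := by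
  rw [centredGaussian, integral_map (by fun_prop) (by fun_prop)]
  have := (PiLp.continuousLinearEquiv 2 ℝ fun _ : ι => ℝ).toContinuousLinearMap.integral_comp_comm
    (IsGaussian.integrable_id (μ := multivariateGaussian 0 S))
  exact this.trans (by simp)

lemma integrable_of_hasLaw_centredGaussian {S : Matrix ι ι ℝ} {X : Ω → ι → ℝ}
    (hX : HasLaw X (centredGaussian S) μ) : Integrable X μ := by
  have h := centredGaussian_integrable_id S
  rw [← hX.map_eq] at h
  exact (integrable_map_measure (by fun_prop) hX.aemeasurable).1 h

lemma integral_of_hasLaw_centredGaussian {S : Matrix ι ι ℝ} {X : Ω → ι → ℝ}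
    (hX : HasLaw X (centredGaussian S) μ) : ∫ ω, X ω ∂μ = 0 := by
  rw [hX.integral_eq, integral_id_centredGaussian]

end Gaussian

/-! ### Independence of σ-algebras -/

section Independence

variable {Ω : Type*} {mΩ : MeasurableSpace Ω} {μ : Measure Ω}

/-- If `m₁` is independent of `m₂` and `m₃` of `m₁ ⊔ m₂`, then `m₁` is independent of `m₂ ⊔ m₃`. -/
lemma indep_sup_of_indep_sup [IsProbabilityMeasure μ] {m₁ m₂ m₃ : MeasurableSpace Ω}
    (h₁ : m₁ ≤ mΩ) (h₂ : m₂ ≤ mΩ) (h₃ : m₃ ≤ mΩ)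
    (h12 : Indep m₁ m₂ μ) (h123 : Indep (m₁ ⊔ m₂) m₃ μ) : Indep m₁ (m₂ ⊔ m₃) μ := by
  let π : Set (Set Ω) := {t | ∃ a b, MeasurableSet[m₂] a ∧ MeasurableSet[m₃] b ∧ t = a ∩ b}
  have hπ : m₂ ⊔ m₃ = MeasurableSpace.generateFrom π := by
    apply le_antisymm
    · refine sup_le (fun a ha => ?_) fun b hb => ?_
      · exact MeasurableSpace.measurableSet_generateFrom
          ⟨a, Set.univ, ha, MeasurableSet.univ, by simp⟩
      · exact MeasurableSpace.measurableSet_generateFrom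
          ⟨Set.univ, b, MeasurableSet.univ, hb, by simp⟩
    · refine MeasurableSpace.generateFrom_le ?_
      rintro t ⟨a, b, ha, hb, rfl⟩
      exact MeasurableSet.inter (le_sup_left (a := m₂) (b := m₃) a ha)
        (le_sup_right (a := m₂) (b := m₃) b hb)
  have hpi : IsPiSystem π := by
    rintro _ ⟨a, b, ha, hb, rfl⟩ _ ⟨a', b', ha', hb', rfl⟩ -
    exact ⟨a ∩ a', b ∩ b', ha.inter ha', hb.inter hb', by ac_rfl⟩
  refine IndepSets.indep h₁ (sup_le h₂ h₃) (@MeasurableSpace.isPiSystem_measurableSet Ω m₁) hpi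
    (@MeasurableSpace.generateFrom_measurableSet Ω m₁).symm hπ ?_
  rw [IndepSets_iff]
  rintro s _ hs ⟨a, b, ha, hb, rfl⟩
  have hs' : MeasurableSet[m₁ ⊔ m₂] s := le_sup_left (a := m₁) (b := m₂) s hs
  have ha' : MeasurableSet[m₁ ⊔ m₂] a := le_sup_right (a := m₁) (b := m₂) a ha
  rw [← Set.inter_assoc, (Indep_iff _ _ _).1 h123 _ _ (hs'.inter ha') hb,
    (Indep_iff _ _ _).1 h123 _ _ ha' hb, (Indep_iff _ _ _).1 h12 _ _ hs ha, mul_assoc]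

/-- A sequence, each member of which is independent of a `σ`-algebra containing the past of the
sequence, is independent. -/
lemma iIndepFun_of_indep_past [IsProbabilityMeasure μ] {β : Type*} [MeasurableSpace β]
    {X : ℕ → Ω → β} (m : ℕ → MeasurableSpace Ω)
    (hm : ∀ j k, j < k → Measurable[m k] (X j))
    (hX : ∀ k, Indep (m k) (MeasurableSpace.comap (X k) inferInstance) μ) : iIndepFun X μ := by
  rw [iIndepFun_iff_iIndep, iIndep_iff]
  intro T
  induction T using Finset.induction_on_max with
  | empty => simp
  | insert a T hT ih =>
    intro f hf
    have ha : a ∉ T := fun h => lt_irrefl _ (hT a h)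
    rw [Finset.prod_insert ha, Finset.set_biInter_insert, Set.inter_comm,
      (Indep_iff _ _ _).1 (hX a) _ _ ?_ (hf a (Finset.mem_insert_self _ _)),
      ih fun i hi => hf i (Finset.mem_insert_of_mem hi), mul_comm]
    refine Finset.measurableSet_biInter _ fun i hi => ?_
    exact (hm i a (hT i hi)).comap_le _ (hf i (Finset.mem_insert_of_mem hi))

/-- Independence, expressed through functions, from independence of `σ`-algebras. -/
lemma indepFun_of_indep {β γ : Type*} [MeasurableSpace β] [MeasurableSpace γ]
    {m₁ m₂ : MeasurableSpace Ω} {X : Ω → β} {Y : Ω → γ} (h : Indep m₁ m₂ μ)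
    (hX : Measurable[m₁] X) (hY : Measurable[m₂] Y) : IndepFun X Y μ :=
  (IndepFun_iff_Indep _ _ _).2 (indep_of_indep_of_le h hX.comap_le hY.comap_le)

end Independence

/-! ### The algebraic Riccati equation -/

section Riccati

open Filter Topology

variable {a g p : Type*} [Fintype a] [Fintype g] [Fintype p]
  {A : Matrix a a ℝ} {G : Matrix a g ℝ} {C : Matrix p a ℝ} {R : Matrix p p ℝ} {P : Matrix a a ℝ}

lemma posSemidef_conj {b : Type*} [Fintype b] (hP : P.PosSemidef) (M : Matrix b a ℝ) :
    (M * P * Mᵀ).PosSemidef := by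
  simpa using hP.mul_mul_conjTranspose_same M

lemma posSemidef_mul_transpose {b c : Type*} [Fintype b] [Fintype c] (M : Matrix b c ℝ) :
    (M * Mᵀ).PosSemidef := by
  simpa using Matrix.posSemidef_self_mul_conjTranspose M

/-- The innovation covariance is positive definite. -/
lemma posDef_innovation (hR : R.PosDef) (hP : P.PosSemidef) : (C * P * Cᵀ + R).PosDef := by
  have h : (C * P * Cᵀ).PosSemidef := by simpa using hP.mul_mul_conjTranspose_same C
  exact Matrix.PosDef.posSemidef_add h hR

/-- The error covariance one step after `P` for the predictor with the arbitrary gain `K`. -/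
def gainUpdate (A : Matrix a a ℝ) (G : Matrix a g ℝ) (C : Matrix p a ℝ) (R : Matrix p p ℝ)
    (K : Matrix a p ℝ) (P : Matrix a a ℝ) : Matrix a a ℝ :=
  (A - K * C) * P * (A - K * C)ᵀ + K * R * Kᵀ + G * Gᵀ

lemma posSemidef_gainUpdate_sub {P' : Matrix a a ℝ} (K : Matrix a p ℝ)
    (h : (P' - P).PosSemidef) :
    (gainUpdate A G C R K P' - gainUpdate A G C R K P).PosSemidef := by
  have : gainUpdate A G C R K P' - gainUpdate A G C R K P =
      (A - K * C) * (P' - P) * (A - K * C)ᵀ := by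
    simp only [gainUpdate, Matrix.mul_sub (A - K * C), Matrix.sub_mul _ _ (A - K * C)ᵀ]
    abel
  rw [this]
  exact posSemidef_conj h _

lemma isClosed_posSemidef : IsClosed {X : Matrix a a ℝ | X.PosSemidef} := by
  simp only [Matrix.posSemidef_iff_dotProduct_mulVec, Set.ofPred_and, Set.ofPred_forall,
    Matrix.IsHermitian]
  refine IsClosed.inter (isClosed_eq (by fun_prop) continuous_id) ?_
  exact isClosed_iInter fun x => isClosed_le continuous_const (by fun_prop)

variable [DecidableEq p]

/-- The right hand side of the algebraic Riccati equation. -/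
def riccatiMap (A : Matrix a a ℝ) (G : Matrix a g ℝ) (C : Matrix p a ℝ) (R : Matrix p p ℝ)
    (P : Matrix a a ℝ) : Matrix a a ℝ :=
  A * P * Aᵀ - A * P * Cᵀ * (C * P * Cᵀ + R)⁻¹ * (C * P * Aᵀ) + G * Gᵀ

lemma kalmanGain_mul_innovation (hR : R.PosDef) (hP : P.PosSemidef) :
    kalmanGain A C R P * (C * P * Cᵀ + R) = A * P * Cᵀ :=
  Matrix.nonsing_inv_mul_cancel_right _ _ (posDef_innovation hR hP).det_pos.ne'.isUnit

/-- Completion of the square: the Kalman gain minimizes the updated error covariance. -/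
lemma gainUpdate_eq (hR : R.PosDef) (hP : P.PosSemidef) (K : Matrix a p ℝ) :
    gainUpdate A G C R K P = riccatiMap A G C R P +
      (K - kalmanGain A C R P) * (C * P * Cᵀ + R) * (K - kalmanGain A C R P)ᵀ := by
  have hS := posDef_innovation (C := C) hR hP
  have h1 := kalmanGain_mul_innovation (A := A) (C := C) hR hP
  have hPt : Pᵀ = P := by simpa using hP.1.eq
  have hSt : (C * P * Cᵀ + R)ᵀ = C * P * Cᵀ + R := by simpa using hS.1.eq
  have h2 : (C * P * Cᵀ + R) * (kalmanGain A C R P)ᵀ = C * P * Aᵀ := by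
    rw [← hSt, ← Matrix.transpose_mul, h1]
    simp [Matrix.mul_assoc, hPt]
  have h3 : riccatiMap A G C R P = A * P * Aᵀ - kalmanGain A C R P * (C * P * Aᵀ) + G * Gᵀ := rfl
  have h4 : (K - kalmanGain A C R P) * (C * P * Cᵀ + R) * (K - kalmanGain A C R P)ᵀ =
      K * (C * P * Cᵀ + R) * Kᵀ - A * P * Cᵀ * Kᵀ - K * (C * P * Aᵀ) +
        kalmanGain A C R P * (C * P * Aᵀ) := by
    rw [Matrix.transpose_sub, Matrix.mul_sub, Matrix.sub_mul, h1, Matrix.sub_mul, Matrix.sub_mul,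
      Matrix.mul_assoc K _ (kalmanGain A C R P)ᵀ, h2]
    nth_rw 2 [← h1]
    rw [Matrix.mul_assoc (kalmanGain A C R P), h2]
    abel
  rw [h3, h4, gainUpdate]
  simp only [Matrix.transpose_sub, Matrix.transpose_mul, Matrix.mul_sub, Matrix.sub_mul,
    Matrix.mul_add, Matrix.add_mul, Matrix.mul_assoc]
  abel

lemma gainUpdate_kalmanGain (hR : R.PosDef) (hP : P.PosSemidef) :
    gainUpdate A G C R (kalmanGain A C R P) P = riccatiMap A G C R P := by
  simp [gainUpdate_eq hR hP]

lemma posSemidef_riccatiMap (hR : R.PosDef) (hP : P.PosSemidef) :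
    (riccatiMap A G C R P).PosSemidef := by
  rw [← gainUpdate_kalmanGain hR hP]
  exact ((posSemidef_conj hP _).add (posSemidef_conj hR.posSemidef _)).add
    (posSemidef_mul_transpose G)

lemma posSemidef_gainUpdate_sub_riccatiMap (hR : R.PosDef) (hP : P.PosSemidef)
    (K : Matrix a p ℝ) : (gainUpdate A G C R K P - riccatiMap A G C R P).PosSemidef := by
  rw [gainUpdate_eq hR hP, add_sub_cancel_left]
  exact posSemidef_conj (posDef_innovation hR hP).posSemidef _

/-- The Riccati recursion is monotone. -/
lemma posSemidef_riccatiMap_sub {P' : Matrix a a ℝ} (hR : R.PosDef) (hP : P.PosSemidef)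
    (hP' : P'.PosSemidef) (h : (P' - P).PosSemidef) :
    (riccatiMap A G C R P' - riccatiMap A G C R P).PosSemidef := by
  rw [← gainUpdate_kalmanGain hR hP']
  have := (posSemidef_gainUpdate_sub (A := A) (G := G) (C := C) (R := R)
    (kalmanGain A C R P') h).add
    (posSemidef_gainUpdate_sub_riccatiMap (A := A) (G := G) (C := C) hR hP (kalmanGain A C R P'))
  simpa using this

lemma continuousAt_riccatiMap (hR : R.PosDef) (hP : P.PosSemidef) :
    ContinuousAt (riccatiMap A G C R) P := by
  have hdet : (C * P * Cᵀ + R).det ≠ 0 := (posDef_innovation hR hP).det_pos.ne'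
  have hS : Continuous fun X : Matrix a a ℝ => C * X * Cᵀ + R := by fun_prop
  have hd : ContinuousAt (fun X : Matrix a a ℝ => (C * X * Cᵀ + R).det⁻¹) P :=
    hS.matrix_det.continuousAt.inv₀ hdet
  have hinv : ContinuousAt (fun X : Matrix a a ℝ => (C * X * Cᵀ + R)⁻¹) P := by
    simp only [Matrix.inv_def, Ring.inverse_eq_inv']
    exact hd.smul hS.matrix_adjugate.continuousAt
  let h : Matrix a a ℝ × Matrix p p ℝ → Matrix a a ℝ := fun z =>
    A * z.1 * Aᵀ - A * z.1 * Cᵀ * z.2 * (C * z.1 * Aᵀ) + G * Gᵀ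
  have hh : Continuous h := by fun_prop
  have heq : riccatiMap A G C R = h ∘ fun X => (X, (C * X * Cᵀ + R)⁻¹) := rfl
  have hp : Tendsto (fun X : Matrix a a ℝ => (X, (C * X * Cᵀ + R)⁻¹)) (𝓝 P)
      (𝓝 (P, (C * P * Cᵀ + R)⁻¹)) := tendsto_id.prodMk_nhds hinv
  rw [heq, ContinuousAt]
  exact (hh.tendsto _).comp hp

variable [DecidableEq a]

/-- A sequence of symmetric matrices that increases and is bounded above in the Loewner order
converges. -/
lemma exists_tendsto_of_loewner_monotone {X : ℕ → Matrix a a ℝ} {Y : Matrix a a ℝ}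
    (hX : ∀ k, (X k).PosSemidef) (hmono : ∀ k, (X (k + 1) - X k).PosSemidef)
    (hY : ∀ k, (Y - X k).PosSemidef) : ∃ Z, Tendsto X atTop (𝓝 Z) := by
  have hq : ∀ x : a → ℝ, ∃ l, Tendsto (fun k => x ⬝ᵥ X k *ᵥ x) atTop (𝓝 l) := by
    intro x
    refine ⟨_, tendsto_atTop_ciSup (monotone_nat_of_le_succ fun k => ?_) ⟨x ⬝ᵥ Y *ᵥ x, ?_⟩⟩
    · have := (hmono k).dotProduct_mulVec_nonneg x
      simpa [Matrix.sub_mulVec, dotProduct_sub] using this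
    · rintro _ ⟨k, rfl⟩
      have := (hY k).dotProduct_mulVec_nonneg x
      simpa [Matrix.sub_mulVec, dotProduct_sub] using this
  choose q hq using hq
  have hpol : ∀ k i j, X k i j = ((Pi.single i 1 + Pi.single j 1) ⬝ᵥ
      X k *ᵥ (Pi.single i 1 + Pi.single j 1) - Pi.single i 1 ⬝ᵥ X k *ᵥ Pi.single i 1
      - Pi.single j 1 ⬝ᵥ X k *ᵥ Pi.single j 1) / 2 := by
    intro k i j
    have hs : X k j i = X k i j := by simpa using (hX k).1.apply i j
    simp [Matrix.mulVec_add, add_dotProduct, hs]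
    ring
  refine ⟨Matrix.of fun i j => (q (Pi.single i 1 + Pi.single j 1) - q (Pi.single i 1)
    - q (Pi.single j 1)) / 2, ?_⟩
  refine tendsto_pi_nhds.2 fun i => tendsto_pi_nhds.2 fun j => ?_
  simp_rw [hpol _ i j]
  exact (((hq _).sub (hq _)).sub (hq _)).div_const 2

attribute [local instance] Matrix.linftyOpNormedRing Matrix.linftyOpNormedAlgebra in
/-- The powers of a Schur stable matrix decay geometrically. -/
lemma exists_norm_pow_le_of_spectrum {F : Matrix a a ℝ}
    (hF : ∀ z ∈ spectrum ℂ (F.map Complex.ofReal), ‖z‖ < 1) :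
    ∃ r : ℝ, 0 ≤ r ∧ r < 1 ∧ ∀ᶠ k in atTop, ‖F ^ k‖ ≤ r ^ k := by
  cases isEmpty_or_nonempty a
  · refine ⟨0, le_rfl, one_pos, Eventually.of_forall fun k => ?_⟩
    rw [Subsingleton.elim (F ^ k) 0, norm_zero]
    positivity
  have : CompleteSpace (Matrix a a ℂ) := FiniteDimensional.complete ℂ _
  have hr := spectrum.spectralRadius_lt_of_forall_lt (F.map Complex.ofReal) (r := 1)
    fun z hz => by exact_mod_cast hF z hz
  obtain ⟨r, hr1, hr2⟩ := ENNReal.lt_iff_exists_nnreal_btwn.1 hr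
  have hr2 : r < 1 := by exact_mod_cast hr2
  have ht := spectrum.pow_nnnorm_pow_one_div_tendsto_nhds_spectralRadius (F.map Complex.ofReal)
  refine ⟨r, r.2, by exact_mod_cast hr2, ?_⟩
  filter_upwards [ht.eventually (gt_mem_nhds hr1), eventually_gt_atTop 0] with k hk hk0
  have hmap : (F.map Complex.ofReal) ^ k = (F ^ k).map Complex.ofReal :=
    (map_pow (Complex.ofRealHom.mapMatrix (m := a)) F k).symm
  have hn : ‖(F ^ k).map Complex.ofReal‖₊ = ‖F ^ k‖₊ := by
    simp [Matrix.linfty_opNNNorm_def]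
  rw [hmap, hn] at hk
  have hk' : (‖F ^ k‖₊ : ENNReal) ≤ (r : ENNReal) ^ (k : ℝ) := by
    have := ENNReal.rpow_le_rpow hk.le (Nat.cast_nonneg k)
    rwa [← ENNReal.rpow_mul, one_div, inv_mul_cancel₀ (by positivity), ENNReal.rpow_one] at this
  rw [ENNReal.rpow_natCast] at hk'
  exact_mod_cast hk'

attribute [local instance] Matrix.linftyOpNormedRing Matrix.linftyOpNormedAlgebra in
/-- For Schur stable `F`, the Lyapunov equation `X = F X Fᵀ + V` with `V ⪰ 0` has a positive
semidefinite solution. -/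
lemma exists_posSemidef_lyapunov {F V : Matrix a a ℝ} (hV : V.PosSemidef)
    (hF : ∀ z ∈ spectrum ℂ (F.map Complex.ofReal), ‖z‖ < 1) :
    ∃ X : Matrix a a ℝ, X.PosSemidef ∧ X = F * X * Fᵀ + V := by
  have hFt : ∀ z ∈ spectrum ℂ (Fᵀ.map Complex.ofReal), ‖z‖ < 1 := by
    intro z hz
    refine hF z fun hu => hz ?_
    have ht : algebraMap ℂ (Matrix a a ℂ) z - Fᵀ.map Complex.ofReal =
        (algebraMap ℂ (Matrix a a ℂ) z - F.map Complex.ofReal)ᵀ := by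
      simp [Matrix.transpose_map, Matrix.algebraMap_eq_diagonal]
    rw [spectrum.mem_resolventSet_iff, ht, Matrix.isUnit_transpose]
    exact hu
  obtain ⟨r, hr0, hr1, hr⟩ := exists_norm_pow_le_of_spectrum hF
  obtain ⟨q, hq0, hq1, hq⟩ := exists_norm_pow_le_of_spectrum hFt
  have hs : Summable fun k => F ^ k * V * (Fᵀ) ^ k := by
    refine Summable.of_norm_bounded_eventually_nat
      ((summable_geometric_of_lt_one (mul_nonneg hr0 hq0)
        (mul_lt_one_of_nonneg_of_lt_one_left hr0 hr1 hq1.le)).mul_left ‖V‖) ?_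
    filter_upwards [hr, hq] with k h1 h2
    calc ‖F ^ k * V * (Fᵀ) ^ k‖ ≤ ‖F ^ k‖ * ‖V‖ * ‖(Fᵀ) ^ k‖ :=
          (norm_mul_le _ _).trans (by gcongr; exact norm_mul_le _ _)
      _ ≤ r ^ k * ‖V‖ * q ^ k := by gcongr
      _ = ‖V‖ * (r * q) ^ k := by rw [mul_pow]; ring
  refine ⟨∑' k, F ^ k * V * (Fᵀ) ^ k, ?_, ?_⟩
  · refine isClosed_posSemidef.mem_of_tendsto hs.hasSum.tendsto_sum_nat
      (Eventually.of_forall fun k => Matrix.posSemidef_sum _ fun i _ => ?_)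
    rw [← Matrix.transpose_pow]
    exact posSemidef_conj hV _
  · conv_lhs => rw [hs.tsum_eq_zero_add]
    rw [← Summable.tsum_mul_left (hf := hs), ← Summable.tsum_mul_right (hf := hs.mul_left _),
      add_comm]
    simp [pow_succ', ← (Commute.self_pow Fᵀ _).eq, mul_assoc]

/-- A detectable system has a steady-state error covariance: the limit of the Riccati recursion
started at `0`. -/
lemma exists_isSteadyStateCovariance (hR : R.PosDef) (h : IsDetectable A C) :
    ∃ P, IsSteadyStateCovariance A G C R P := by
  obtain ⟨K, hK⟩ := h
  obtain ⟨Y, hY, hYeq⟩ := exists_posSemidef_lyapunov (V := K * R * Kᵀ + G * Gᵀ)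
    ((posSemidef_conj hR.posSemidef K).add (posSemidef_mul_transpose G)) hK
  have hYeq' : gainUpdate A G C R K Y = Y := by
    rw [gainUpdate, add_assoc]
    exact hYeq.symm
  let X : ℕ → Matrix a a ℝ := fun k => (riccatiMap A G C R)^[k] 0
  have hX0 : X 0 = 0 := rfl
  have hXs : ∀ k, X (k + 1) = riccatiMap A G C R (X k) := fun k =>
    Function.iterate_succ_apply' _ _ _
  have hX : ∀ k, (X k).PosSemidef := by
    intro k
    induction k with
    | zero => exact Matrix.PosSemidef.zero
    | succ k ih => rw [hXs]; exact posSemidef_riccatiMap hR ih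
  have hmono : ∀ k, (X (k + 1) - X k).PosSemidef := by
    intro k
    induction k with
    | zero => rw [hX0, sub_zero]; exact hX 1
    | succ k ih =>
      rw [hXs, hXs k]
      rw [hXs] at ih
      exact posSemidef_riccatiMap_sub hR (hX k) (hXs k ▸ hX (k + 1)) ih
  have hle : ∀ k, (Y - X k).PosSemidef := by
    intro k
    induction k with
    | zero => rw [hX0, sub_zero]; exact hY
    | succ k ih =>
      have h1 := posSemidef_gainUpdate_sub (A := A) (G := G) (C := C) (R := R) K ih
      have h2 := posSemidef_gainUpdate_sub_riccatiMap (A := A) (G := G) (C := C) hR (hX k) K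
      rw [hYeq'] at h1
      rw [hXs]
      simpa using h1.add h2
  obtain ⟨Z, hZ⟩ := exists_tendsto_of_loewner_monotone hX hmono hle
  have hZp : Z.PosSemidef := isClosed_posSemidef.mem_of_tendsto hZ (Eventually.of_forall hX)
  refine ⟨Z, hZp, ?_⟩
  have h1 : Tendsto (fun k => X (k + 1)) atTop (𝓝 (riccatiMap A G C R Z)) := by
    simp_rw [hXs]
    exact (continuousAt_riccatiMap hR hZp).tendsto.comp hZ
  exact tendsto_nhds_unique (hZ.comp (tendsto_add_atTop_nat 1)) h1

end Riccati

/-! ### Trajectories of the augmented system -/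

section Augmented

variable {n m p ns nf s rw : ℕ} {S : DescriptorSystem n m p} (W : QuasiWeierstrass S ns nf s rw)

lemma Aξ_mulVec_inl (x : W.AugIdx → ℝ) :
    (fun i => (W.Aξ *ᵥ x) (Sum.inl i)) = W.J *ᵥ (fun i => x (Sum.inl i)) +
      W.Ls *ᵥ fun b => x (Sum.inr (0, b)) := by
  have h : W.S₀ *ᵥ (x ∘ Sum.inr) = fun b => x (Sum.inr (0, b)) := by
    funext b
    simp only [Matrix.mulVec, dotProduct, QuasiWeierstrass.S₀, Matrix.of_apply]
    rw [Finset.sum_eq_single (0, b)]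
    · simp
    · rintro ⟨i, c⟩ - hne
      rw [if_neg, zero_mul]
      rintro ⟨rfl, rfl⟩
      exact hne rfl
    · simp
  funext i
  rw [← h, QuasiWeierstrass.Aξ, ← Sum.elim_comp_inl_inr x, Matrix.fromBlocks_mulVec]
  simp only [Sum.elim_inl, Matrix.mulVec_mulVec]
  rfl

lemma Aξ_mulVec_inr_castSucc (x : W.AugIdx → ℝ) (i : Fin s) (b : Fin rw) :
    (W.Aξ *ᵥ x) (Sum.inr (i.castSucc, b)) = x (Sum.inr (i.succ, b)) := by
  rw [QuasiWeierstrass.Aξ, ← Sum.elim_comp_inl_inr x, Matrix.fromBlocks_mulVec]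
  simp only [Sum.elim_inr, Matrix.zero_mulVec, zero_add, Function.comp_apply]
  simp only [Matrix.mulVec, dotProduct, QuasiWeierstrass.Aη, Matrix.of_apply]
  rw [Finset.sum_eq_single (i.succ, b)]
  · simp
  · rintro ⟨j, c⟩ - hne
    rw [if_neg, zero_mul]
    rintro ⟨h1, rfl⟩
    exact hne (Prod.ext (Fin.ext (by simpa using h1)) rfl)
  · simp

lemma Aξ_mulVec_inr_last (x : W.AugIdx → ℝ) (b : Fin rw) :
    (W.Aξ *ᵥ x) (Sum.inr (Fin.last s, b)) = 0 := by
  rw [QuasiWeierstrass.Aξ, ← Sum.elim_comp_inl_inr x, Matrix.fromBlocks_mulVec]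
  simp only [Sum.elim_inr, Matrix.zero_mulVec, zero_add]
  simp only [Matrix.mulVec, dotProduct, QuasiWeierstrass.Aη, Matrix.of_apply]
  refine Finset.sum_eq_zero ?_
  rintro ⟨j, c⟩ -
  rw [if_neg, zero_mul]
  rintro ⟨h1, -⟩
  have := j.2
  simp at h1
  omega

lemma Bξ_mulVec_inl (x : Fin m → ℝ) :
    (fun i => (W.Bξ *ᵥ x) (Sum.inl i)) = W.Bs *ᵥ x := by
  funext i
  simp [QuasiWeierstrass.Bξ, Matrix.fromRows_mulVec]

lemma Bξ_mulVec_inr (x : Fin m → ℝ) (j : W.BufIdx) : (W.Bξ *ᵥ x) (Sum.inr j) = 0 := by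
  simp [QuasiWeierstrass.Bξ, Matrix.fromRows_mulVec]

lemma Gξ_mulVec_inl (x : Fin rw → ℝ) (i : Fin ns) : (W.Gξ *ᵥ x) (Sum.inl i) = 0 := by
  simp [QuasiWeierstrass.Gξ, Matrix.fromRows_mulVec]

lemma Gξ_mulVec_inr (x : Fin rw → ℝ) (i : Fin (s + 1)) (b : Fin rw) :
    (W.Gξ *ᵥ x) (Sum.inr (i, b)) = if i = Fin.last s then x b else 0 := by
  simp only [QuasiWeierstrass.Gξ, Matrix.fromRows_mulVec, Sum.elim_inr]
  simp only [Matrix.mulVec, dotProduct, QuasiWeierstrass.Bη, Matrix.of_apply]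
  by_cases h : i = Fin.last s <;> simp [h]

lemma N_pow_eq_zero : W.N ^ s = 0 := by
  have := pow_nilpotencyClass W.isNilpotent_N
  rwa [W.index_N] at this

/-- The output matrix applied to a slow state and a noise buffer; the block of index `s` does not
contribute because `N ^ s = 0`. -/
lemma Cξ_mulVec (x : W.AugIdx → ℝ) :
    W.Cξ *ᵥ x = W.Cs *ᵥ (fun i => x (Sum.inl i)) -
      W.Cf *ᵥ ∑ i : Fin s, (W.N ^ (i : ℕ)) *ᵥ (W.Lf *ᵥ fun b => x (Sum.inr (i.castSucc, b))) := by
  have hSf : W.Sf *ᵥ (x ∘ Sum.inr) =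
      fun j => (W.Lf *ᵥ fun b => x (Sum.inr (j.1, b))) j.2 := by
    funext ⟨i, c⟩
    simp only [Matrix.mulVec, dotProduct, QuasiWeierstrass.Sf, Matrix.kroneckerMap_apply,
      Fintype.sum_prod_type, Function.comp_apply]
    rw [Finset.sum_eq_single i]
    · simp
    · intro j _ hj
      simp [Matrix.one_apply_ne hj.symm]
    · simp
  have hM : ∀ f : Fin (s + 1) × Fin nf → ℝ, W.M *ᵥ f =
      ∑ i : Fin s, (W.N ^ (i : ℕ)) *ᵥ fun a => f (i.castSucc, a) := by
    intro f
    have : W.M *ᵥ f = ∑ i : Fin (s + 1), (W.N ^ (i : ℕ)) *ᵥ fun a => f (i, a) := by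
      funext a
      simp [Matrix.mulVec, dotProduct, QuasiWeierstrass.M, Fintype.sum_prod_type]
    rw [this, Fin.sum_univ_castSucc]
    simp [N_pow_eq_zero W]
  rw [QuasiWeierstrass.Cξ, ← Sum.elim_comp_inl_inr x, Matrix.fromCols_mulVec_sumElim,
    Matrix.neg_mulVec, ← Matrix.mulVec_mulVec, ← Matrix.mulVec_mulVec, hSf, hM, sub_eq_add_neg]
  rfl

variable {W} {u : ℕ → Fin m → ℝ} {Ω : Type*} [mΩ : MeasurableSpace Ω] {μ : Measure Ω}
  {μ₀ : Measure (Fin ns → ℝ)} {ε : ℕ → Ω → Fin rw → ℝ} {v : ℕ → Ω → Fin p → ℝ}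
  {ξ : ℕ → Ω → W.AugIdx → ℝ} {ytil : ℕ → Ω → Fin p → ℝ}

lemma IsAugmentedProcess.buffer_eq (h : IsAugmentedProcess W u μ ε v ξ ytil)
    (h0 : HasBufferedInit W μ₀ μ ε v ξ) (k : ℕ) (ω : Ω) (i : Fin (s + 1)) (b : Fin rw) :
    ξ k ω (Sum.inr (i, b)) = ε (k + i.val) ω b := by
  induction k generalizing i with
  | zero => rw [h0.buffer_init, zero_add]
  | succ k ih =>
    rw [h.state_eq]
    simp only [Pi.add_apply, Bξ_mulVec_inr, Gξ_mulVec_inr, add_zero]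
    induction i using Fin.lastCases with
    | last =>
      rw [Aξ_mulVec_inr_last, if_pos rfl, zero_add, Fin.val_last, add_right_comm]
    | cast i =>
      rw [Aξ_mulVec_inr_castSucc, if_neg (Fin.castSucc_lt_last i).ne, ih, add_zero,
        Fin.val_succ, Fin.val_castSucc, add_right_comm, add_assoc]

lemma IsAugmentedProcess.slow_eq (h : IsAugmentedProcess W u μ ε v ξ ytil)
    (h0 : HasBufferedInit W μ₀ μ ε v ξ) (k : ℕ) (ω : Ω) :
    (fun i => ξ (k + 1) ω (Sum.inl i)) = W.J *ᵥ (fun i => ξ k ω (Sum.inl i)) + W.Bs *ᵥ u k +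
      W.Ls *ᵥ ε k ω := by
  have hA := Aξ_mulVec_inl W (ξ k ω)
  have hB := Bξ_mulVec_inl W (u k)
  have hb : (fun b => ξ k ω (Sum.inr (0, b))) = ε k ω := by
    funext b
    rw [h.buffer_eq h0]
    simp
  rw [hb] at hA
  funext i
  have hA := congrFun hA i
  have hB := congrFun hB i
  simp only [Pi.add_apply] at hA ⊢
  rw [h.state_eq]
  simp only [Pi.add_apply, Gξ_mulVec_inl]
  rw [hA, hB]
  ring

lemma IsAugmentedProcess.output_eq_sum (h : IsAugmentedProcess W u μ ε v ξ ytil)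
    (h0 : HasBufferedInit W μ₀ μ ε v ξ) (k : ℕ) (ω : Ω) :
    ytil k ω = W.Cs *ᵥ (fun i => ξ k ω (Sum.inl i)) -
      W.Cf *ᵥ ∑ i ∈ Finset.range s, (W.N ^ i) *ᵥ (W.Lf *ᵥ ε (k + i) ω) + v k ω := by
  rw [h.output_eq, Cξ_mulVec, Finset.sum_range]
  congr 4
  funext i
  congr 2
  funext b
  rw [h.buffer_eq h0, Fin.val_castSucc]

/-- The state at time `k` is a measurable function of the initial state and the noise that has
entered until then; the `σ`-algebra is arbitrary. -/
lemma measurable_augmented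
    (h : ∀ k ω, ξ (k + 1) ω = W.Aξ *ᵥ ξ k ω + W.Bξ *ᵥ u k + W.Gξ *ᵥ ε (k + s + 1) ω)
    (h0 : Measurable (ξ 0)) {k : ℕ} (hε : ∀ j < k, Measurable (ε (j + s + 1))) :
    Measurable (ξ k) := by
  induction k with
  | zero => exact h0
  | succ k ih =>
    have h1 := ih fun j hj => hε j (hj.trans k.lt_succ_self)
    have h2 := hε k k.lt_succ_self
    rw [show ξ (k + 1) = _ from funext (h k)]
    exact (((measurable_mulVec W.Aξ).comp h1).add_const _).add ((measurable_mulVec W.Gξ).comp h2)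

/-- A Gaussian white noise splits into independent present and past. -/
lemma IsGaussianWhiteNoise.indep_iSup_lt {ι : Type*} [Fintype ι] [DecidableEq ι]
    {V : Matrix ι ι ℝ} {X : ℕ → Ω → ι → ℝ} (h : IsGaussianWhiteNoise V X μ) (k : ℕ) :
    Indep (MeasurableSpace.comap (X k) inferInstance)
      (⨆ j : Fin k, MeasurableSpace.comap (X j) inferInstance) μ := by
  have h1 := indep_iSup_of_disjoint (S := {k}) (T := Set.Iio k)
    (fun i => (h.measurable i).comap_le) ((iIndepFun_iff_iIndep _ _ _).1 h.indep)
    (by simp)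
  refine indep_of_indep_of_le h1 ?_ ?_
  · exact le_iSup₂_of_le k rfl le_rfl
  · exact iSup_le fun j => le_iSup₂_of_le j.1 j.2 le_rfl

lemma comap_le_comap_pi {Ω ι : Type*} {β : ι → Type*} [∀ i, MeasurableSpace (β i)]
    (X : ∀ i, Ω → β i) (i : ι) :
    MeasurableSpace.comap (X i) inferInstance ≤
      MeasurableSpace.comap (fun ω i => X i ω) inferInstance := by
  have : X i = (fun f => f i) ∘ fun ω i => X i ω := rfl
  conv_lhs => rw [this, ← MeasurableSpace.comap_comp]
  exact MeasurableSpace.comap_mono (measurable_pi_apply i).comap_le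

/-- Version of `measurable_augmented` for a buffered initial state and the whole history. -/
lemma measurable_augmented_history
    (h : ∀ k ω, ξ (k + 1) ω = W.Aξ *ᵥ ξ k ω + W.Bξ *ᵥ u k + W.Gξ *ᵥ ε (k + s + 1) ω)
    (hbuf : ∀ ω i b, ξ 0 ω (Sum.inr (i, b)) = ε i.val ω b) {k : ℕ}
    (hε : ∀ j < k + s + 1, Measurable (ε j)) (hv : Measurable fun ω k => v k ω)
    (hx : Measurable fun ω i => ξ 0 ω (Sum.inl i)) :
    Measurable fun ω => ((fun j : Fin (k + 1) => ξ j ω), (fun j => v j ω)) := by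
  have hξ0 : Measurable (ξ 0) := by
    refine measurable_pi_lambda _ ?_
    rintro (i | ⟨i, b⟩)
    · exact (measurable_pi_apply i).comp hx
    · simp_rw [hbuf]
      exact (measurable_pi_apply b).comp (hε _ (by omega))
  exact (measurable_pi_lambda _ fun j => measurable_augmented h hξ0
    fun i hi => hε _ (by omega)).prodMk hv

/-- The noise `ε k` is independent of the earlier noise, the measurement noise and the initial slow
state together. -/
lemma IsAugmentedProcess.indep_noise_history [IsProbabilityMeasure μ]
    (h : IsAugmentedProcess W u μ ε v ξ ytil)
    (h0 : HasBufferedInit W μ₀ μ ε v ξ) (k : ℕ) :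
    Indep (MeasurableSpace.comap (ε k) inferInstance)
      ((⨆ j : Fin k, MeasurableSpace.comap (ε j) inferInstance) ⊔
        MeasurableSpace.comap (fun ω k => v k ω) inferInstance ⊔
        MeasurableSpace.comap (fun ω i => ξ 0 ω (Sum.inl i)) inferInstance) μ := by
  have hε : Measurable fun ω k => ε k ω := measurable_pi_iff.2 h.white_ε.measurable
  have hv : Measurable fun ω k => v k ω := measurable_pi_iff.2 h.white_v.measurable
  have hx : Measurable fun ω i => ξ 0 ω (Sum.inl i) :=
    measurable_pi_iff.2 fun i => (measurable_pi_apply (Sum.inl i)).comp h.measurable_init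
  have h12 : MeasurableSpace.comap (ε k) inferInstance ⊔
      (⨆ j : Fin k, MeasurableSpace.comap (ε j) inferInstance) ≤
      MeasurableSpace.comap (fun ω k => ε k ω) inferInstance :=
    sup_le (comap_le_comap_pi ε _) (iSup_le fun j => comap_le_comap_pi ε j)
  have hm₂ : (⨆ j : Fin k, MeasurableSpace.comap (ε j) inferInstance) ≤ mΩ :=
    le_sup_right.trans (h12.trans hε.comap_le)
  refine indep_sup_of_indep_sup (h.white_ε.measurable _).comap_le (sup_le hm₂ hv.comap_le)
    hx.comap_le ?_ ?_
  · refine indep_sup_of_indep_sup (h.white_ε.measurable _).comap_le hm₂ hv.comap_le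
      (h.white_ε.indep_iSup_lt _) (indep_of_indep_of_le_left ?_ h12)
    exact (IndepFun_iff_Indep _ _ _).1 h.indep_noise
  · refine indep_of_indep_of_le_left ((IndepFun_iff_Indep _ _ _).1 h0.indep_init.symm) ?_
    rw [← sup_assoc]
    exact (sup_le_sup_right h12 _).trans (MeasurableSpace.comap_prodMk _ _).ge

lemma IsAugmentedProcess.indepFun_noise [IsProbabilityMeasure μ]
    (h : IsAugmentedProcess W u μ ε v ξ ytil)
    (h0 : HasBufferedInit W μ₀ μ ε v ξ) (k : ℕ) :
    IndepFun (ε (k + s + 1))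
      (fun ω => ((fun j : Fin (k + 1) => ξ j ω), (fun j => v j ω))) μ := by
  refine indepFun_of_indep (h.indep_noise_history h0 (k + s + 1)) (comap_measurable _) ?_
  refine @measurable_augmented_history n m p ns nf s rw S W u Ω (_) ε v ξ h.state_eq
    h0.buffer_init k (fun j hj => ?_) ?_ ?_
  · rw [measurable_iff_comap_le]
    exact le_sup_of_le_left (le_sup_of_le_left
      (le_iSup (fun j : Fin (k + s + 1) => MeasurableSpace.comap (ε j) inferInstance) ⟨j, hj⟩))
  · rw [measurable_iff_comap_le]
    exact le_sup_of_le_left le_sup_right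
  · rw [measurable_iff_comap_le]
    exact le_sup_right

end Augmented

/-! ### One step of the steady-state Kalman filter -/

section Innovation

variable {a g p Ω : Type*} [Fintype a] [Fintype g] [Fintype p] {A : Matrix a a ℝ}
  {G : Matrix a g ℝ} {C : Matrix p a ℝ} {R : Matrix p p ℝ} {P : Matrix a a ℝ}

/-- The innovation and the next prediction error are measurable functions of the prediction error
and the pair `n` of entering noises; the `σ`-algebra on `Ω` is arbitrary. -/
lemma measurable_innovation_step [MeasurableSpace Ω] {X : Ω → a → ℝ} {n : Ω → (g → ℝ) × (p → ℝ)}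
    (K : Matrix a p ℝ) (hX : Measurable X) (hn : Measurable n) {e : Ω → p → ℝ}
    (he : ∀ ω, e ω = C *ᵥ X ω + (n ω).2) {X' : Ω → a → ℝ}
    (hX' : ∀ ω, X' ω = A *ᵥ X ω + G *ᵥ (n ω).1 - K *ᵥ e ω) : Measurable e ∧ Measurable X' := by
  have hem : Measurable e := by
    rw [funext he]
    exact ((measurable_mulVec C).comp hX).add (measurable_snd.comp hn)
  refine ⟨hem, ?_⟩
  rw [funext hX']
  exact (((measurable_mulVec A).comp hX).add
    ((measurable_mulVec G).comp (measurable_fst.comp hn))).sub ((measurable_mulVec K).comp hem)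

variable [DecidableEq g] [DecidableEq p]

/-- Covariance of the pair of the next prediction error and the innovation: the blocks are
uncorrelated by the choice of the gain, and the first one is `P` again by the Riccati equation. -/
lemma innovation_covariance (hR : R.PosDef) (hP : IsSteadyStateCovariance A G C R P) :
    let K := kalmanGain A C R P
    let H : Matrix (a ⊕ p) (a ⊕ (g ⊕ p)) ℝ :=
      Matrix.fromRows (Matrix.fromCols (A - K * C) (Matrix.fromCols G (-K)))
        (Matrix.fromCols C (Matrix.fromCols 0 1))
    H * Matrix.fromBlocks P 0 0 (Matrix.fromBlocks (1 : Matrix g g ℝ) 0 0 R) * Hᵀ =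
      Matrix.fromBlocks P 0 0 (C * P * Cᵀ + R) := by
  intro K H
  have hPt : Pᵀ = P := by simpa using hP.posSemidef.1.eq
  have hRt : Rᵀ = R := by simpa using hR.1.eq
  have hup := gainUpdate_kalmanGain (A := A) (G := G) (C := C) hR hP.posSemidef
  have hric : riccatiMap A G C R P = P := hP.riccati.symm
  have hK : (A - K * C) * P * Cᵀ - K * R = 0 := by
    have := kalmanGain_mul_innovation (A := A) (C := C) hR hP.posSemidef
    rw [Matrix.sub_mul, Matrix.sub_mul, ← this]
    simp only [Matrix.mul_add, Matrix.mul_assoc, K]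
    abel
  have hK' : C * P * (A - K * C)ᵀ - R * Kᵀ = 0 := by
    have := congrArg Matrix.transpose hK
    simpa [Matrix.mul_assoc, hPt, hRt] using this
  have h11 : (A - K * C) * P * (A - K * C)ᵀ + (G * Gᵀ + K * R * Kᵀ) = P := by
    calc _ = gainUpdate A G C R K P := by rw [gainUpdate]; abel
      _ = P := hup.trans hric
  simp only [H, Matrix.transpose_fromRows, Matrix.transpose_fromCols, Matrix.fromRows_mul,
    Matrix.fromCols_mul_fromBlocks, Matrix.mul_fromCols, Matrix.fromCols_mul_fromRows,
    Matrix.mul_zero, Matrix.zero_mul, add_zero, zero_add, Matrix.mul_one, Matrix.transpose_neg,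
    Matrix.transpose_one, Matrix.transpose_zero, Matrix.neg_mul, Matrix.mul_neg, neg_neg,
    Matrix.one_mul]
  have h12 : (A - K * C) * P * Cᵀ + -(K * R) = 0 := by rw [← sub_eq_add_neg, hK]
  have h21 : C * P * (A - K * C)ᵀ + -(R * Kᵀ) = 0 := by rw [← sub_eq_add_neg, hK']
  rw [h11, h12, h21]
  ext (i | i) (j | j) <;> rfl

variable [DecidableEq a] {F : MeasurableSpace Ω} {mΩ : MeasurableSpace Ω} {μ : Measure Ω}
  [IsProbabilityMeasure μ]

/-- One step of the steady-state Kalman filter. If the prediction error `X` has distribution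
`N(0, P)` and is independent of the past `F`, then the next prediction error has the same
distribution and is independent of the past extended by the innovation `e`. -/
lemma innovation_step (hR : R.PosDef) (hP : IsSteadyStateCovariance A G C R P)
    (hF : F ≤ mΩ) {X : Ω → a → ℝ} {ε : Ω → g → ℝ} {v : Ω → p → ℝ}
    (hXm : Measurable X) (hεm : Measurable ε) (hvm : Measurable v)
    (hX : HasLaw X (centredGaussian P) μ) (hε : HasLaw ε (centredGaussian 1) μ)
    (hv : HasLaw v (centredGaussian R) μ) (hεv : IndepFun ε v μ)
    (hFX : Indep F (MeasurableSpace.comap X inferInstance) μ)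
    (hnoise : Indep (F ⊔ MeasurableSpace.comap X inferInstance)
      (MeasurableSpace.comap (fun ω => (ε ω, v ω)) inferInstance) μ)
    {e : Ω → p → ℝ} (he : ∀ ω, e ω = C *ᵥ X ω + v ω)
    {X' : Ω → a → ℝ} (hX' : ∀ ω, X' ω = A *ᵥ X ω + G *ᵥ ε ω - kalmanGain A C R P *ᵥ e ω) :
    HasLaw X' (centredGaussian P) μ ∧ HasLaw e (centredGaussian (C * P * Cᵀ + R)) μ ∧
      Indep F (MeasurableSpace.comap e inferInstance) μ ∧
      Indep (F ⊔ MeasurableSpace.comap e inferInstance)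
        (MeasurableSpace.comap X' inferInstance) μ := by
  set K := kalmanGain A C R P with hK
  have hone : (1 : Matrix g g ℝ).PosSemidef := Matrix.PosSemidef.one
  have h1 := hasLaw_sumElim_centredGaussian hone hR.posSemidef hε hv hεv
  have hbl := posSemidef_fromBlocks_diag hone hR.posSemidef
  have hXn : IndepFun X (fun ω => (ε ω, v ω)) μ :=
    indepFun_of_indep hnoise (measurable_iff_comap_le.2 le_sup_right) (comap_measurable _)
  have h2 := hasLaw_sumElim_centredGaussian hP.posSemidef hbl hX h1
    (hXn.comp measurable_id measurable_sumElim)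
  have h3 := hasLaw_mulVec_centredGaussian (posSemidef_fromBlocks_diag hP.posSemidef hbl) h2
    (Matrix.fromRows (Matrix.fromCols (A - K * C) (Matrix.fromCols G (-K)))
        (Matrix.fromCols C (Matrix.fromCols 0 1)))
  rw [innovation_covariance hR hP] at h3
  have h4 : (fun ω => Matrix.fromRows (Matrix.fromCols (A - K * C) (Matrix.fromCols G (-K)))
      (Matrix.fromCols C (Matrix.fromCols 0 1)) *ᵥ
        Sum.elim (X ω) (Sum.elim (ε ω) (v ω))) = fun ω => Sum.elim (X' ω) (e ω) := by
    funext ω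
    simp only [Matrix.fromRows_mulVec, Matrix.fromCols_mulVec_sumElim, hX', he, Matrix.sub_mulVec,
      Matrix.neg_mulVec, Matrix.zero_mulVec, Matrix.one_mulVec, Matrix.mulVec_add, zero_add,
      Matrix.mulVec_mulVec]
    congr 1
    abel
  rw [h4] at h3
  obtain ⟨hem, hX'm⟩ := measurable_innovation_step K hXm (hεm.prodMk hvm) he hX'
  obtain ⟨l1, l2, l3⟩ := indepFun_of_hasLaw_sumElim_centredGaussian hP.posSemidef
    (posDef_innovation hR hP.posSemidef).posSemidef h3
  have hn : MeasurableSpace.comap (fun ω => (ε ω, v ω)) inferInstance ≤ mΩ :=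
    (hεm.prodMk hvm).comap_le
  -- the past is independent of the current error together with the entering noise
  have hF' : Indep F (MeasurableSpace.comap X inferInstance ⊔
      MeasurableSpace.comap (fun ω => (ε ω, v ω)) inferInstance) μ :=
    indep_sup_of_indep_sup hF hXm.comap_le hn hFX hnoise
  obtain ⟨me, mX'⟩ := @measurable_innovation_step _ _ _ _ _ _ _ _ _ _
    (MeasurableSpace.comap X inferInstance ⊔
      MeasurableSpace.comap (fun ω => (ε ω, v ω)) inferInstance) _ _ K
    (measurable_iff_comap_le.2 le_sup_left) (measurable_iff_comap_le.2 le_sup_right) _ he _ hX'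
  refine ⟨l1, l2, indep_of_indep_of_le_right hF' me.comap_le, ?_⟩
  rw [sup_comm]
  exact (indep_sup_of_indep_sup hX'm.comap_le hem.comap_le hF
    ((IndepFun_iff_Indep _ _ _).1 l3)
    (indep_of_indep_of_le_left hF'.symm (sup_le mX'.comap_le me.comap_le))).symm

end Innovation

/-! ### Prediction errors along a trajectory -/

section SteadyStateFilter

lemma IsGaussianWhiteNoise.shift {ι : Type*} [Fintype ι] [DecidableEq ι] {Ω : Type*}
    [MeasurableSpace Ω] {V : Matrix ι ι ℝ} {X : ℕ → Ω → ι → ℝ} {μ : Measure Ω}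
    (h : IsGaussianWhiteNoise V X μ) (c : ℕ) :
    IsGaussianWhiteNoise V (fun k => X (k + c)) μ where
  measurable _ := h.measurable _
  hasLaw _ := h.hasLaw _
  indep := h.indep.precomp (add_left_injective c)

lemma iSup_comap_le_comap_pi {Ω β : Type*} [MeasurableSpace β] (X : ℕ → Ω → β) (k : ℕ) :
    ⨆ j : Fin k, MeasurableSpace.comap (X j) inferInstance ≤
      MeasurableSpace.comap (fun ω j => X j ω) inferInstance :=
  iSup_le fun j => comap_le_comap_pi X j

/-- For two independent white noises, the pair of present values is independent of the pair of
pasts. -/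
lemma IsGaussianWhiteNoise.indep_pair {ι κ : Type*} [Fintype ι] [DecidableEq ι] [Fintype κ]
    [DecidableEq κ] {Ω : Type*} [MeasurableSpace Ω] {V : Matrix ι ι ℝ} {V' : Matrix κ κ ℝ}
    {X : ℕ → Ω → ι → ℝ} {Z : ℕ → Ω → κ → ℝ} {μ : Measure Ω} [IsProbabilityMeasure μ]
    (hX : IsGaussianWhiteNoise V X μ) (hZ : IsGaussianWhiteNoise V' Z μ)
    (hXZ : IndepFun (fun ω k => X k ω) (fun ω k => Z k ω) μ) (k : ℕ) :
    Indep (MeasurableSpace.comap (X k) inferInstance ⊔ MeasurableSpace.comap (Z k) inferInstance)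
      ((⨆ j : Fin k, MeasurableSpace.comap (X j) inferInstance) ⊔
        ⨆ j : Fin k, MeasurableSpace.comap (Z j) inferInstance) μ := by
  have hXZ' := (IndepFun_iff_Indep _ _ _).1 hXZ
  have hXk := comap_le_comap_pi X k
  have hZk := comap_le_comap_pi Z k
  have hXp := iSup_comap_le_comap_pi X k
  have hZp := iSup_comap_le_comap_pi Z k
  have mX := (measurable_pi_iff.2 hX.measurable : Measurable fun ω k => X k ω).comap_le
  have mZ := (measurable_pi_iff.2 hZ.measurable : Measurable fun ω k => Z k ω).comap_le
  have h1 := indep_sup_of_indep_sup (hZk.trans mZ) (hZp.trans mZ) (hXp.trans mX)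
    (hZ.indep_iSup_lt k)
    (indep_of_indep_of_le hXZ'.symm (sup_le hZk hZp) hXp)
  have h2 := indep_sup_of_indep_sup (hXk.trans mX) (hXp.trans mX)
    (sup_le (hZk.trans mZ) (hZp.trans mZ)) (hX.indep_iSup_lt k)
    (indep_of_indep_of_le hXZ' (sup_le hXk hXp) (sup_le hZk hZp))
  rw [sup_comm] at h1
  have h3 := indep_sup_of_indep_sup (sup_le (hXp.trans mX) (hZp.trans mZ)) (hZk.trans mZ)
    (hXk.trans mX) (sup_comm (⨆ j : Fin k, MeasurableSpace.comap (Z j) inferInstance) _ ▸ h1.symm)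
    (indep_of_indep_of_le_left h2.symm (by
      rw [sup_assoc, sup_comm (⨆ j : Fin k, MeasurableSpace.comap (Z j) inferInstance)]))
  rw [sup_comm (MeasurableSpace.comap (X k) inferInstance)]
  exact h3.symm

/-- The information available before time `k`: the `σ`-algebra `F` and the outputs until then. -/
abbrev observed {Ω β : Type*} [MeasurableSpace β] (F : MeasurableSpace Ω) (y : ℕ → Ω → β) (k : ℕ) :
    MeasurableSpace Ω :=
  F ⊔ ⨆ j : Fin k, MeasurableSpace.comap (y j) inferInstance

lemma measurable_observed {Ω β : Type*} [MeasurableSpace β] (F : MeasurableSpace Ω)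
    (y : ℕ → Ω → β) {j k : ℕ} (hj : j < k) : Measurable[observed F y k] (y j) :=
  measurable_iff_comap_le.2 (le_sup_of_le_right
    (le_iSup (fun j : Fin k => MeasurableSpace.comap (y j) inferInstance) ⟨j, hj⟩))

lemma observed_succ {Ω β : Type*} [MeasurableSpace β] (F : MeasurableSpace Ω) (y : ℕ → Ω → β)
    (k : ℕ) :
    observed F y (k + 1) = observed F y k ⊔ MeasurableSpace.comap (y k) inferInstance := by
  refine le_antisymm (sup_le (le_sup_of_le_left le_sup_left) (iSup_le fun j => ?_)) (sup_le ?_ ?_)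
  · rcases (Nat.lt_succ_iff_lt_or_eq.1 j.2) with h | h
    · exact le_sup_of_le_left (measurable_iff_comap_le.1 (measurable_observed F y h))
    · rw [h]; exact le_sup_right
  · refine sup_le le_sup_left (iSup_le fun j => ?_)
    exact measurable_iff_comap_le.1 (measurable_observed F y (j.2.trans k.lt_succ_self))
  · exact measurable_iff_comap_le.1 (measurable_observed F y k.lt_succ_self)

lemma observed_mono {Ω β : Type*} [MeasurableSpace β] (F : MeasurableSpace Ω) (y : ℕ → Ω → β) :
    Monotone (observed F y) :=
  monotone_nat_of_le_succ fun k => by rw [observed_succ]; exact le_sup_left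

variable {n m p ns nf s rw : ℕ} {S : DescriptorSystem n m p} {W : QuasiWeierstrass S ns nf s rw}
  {u : ℕ → Fin m → ℝ} {Ω : Type*} {F : MeasurableSpace Ω} [mΩ : MeasurableSpace Ω] {μ : Measure Ω}
  {Pinf : Matrix W.AugIdx W.AugIdx ℝ} {ε : ℕ → Ω → Fin rw → ℝ} {v : ℕ → Ω → Fin p → ℝ}
  {ξ : ℕ → Ω → W.AugIdx → ℝ} {ytil : ℕ → Ω → Fin p → ℝ} {ξhat : ℕ → Ω → W.AugIdx → ℝ}
  {y yhat e : ℕ → Ω → Fin p → ℝ}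

/-- The prediction is a measurable function of its initial value and the past outputs. -/
lemma measurable_prediction {K : Matrix W.AugIdx (Fin p) ℝ}
    (h : ∀ k ω, ξhat (k + 1) ω = W.Aξ *ᵥ ξhat k ω + W.Bξ *ᵥ u k +
      K *ᵥ (ytil k ω - W.Cξ *ᵥ ξhat k ω))
    (h0 : Measurable (ξhat 0)) {k : ℕ} (hy : ∀ j < k, Measurable (ytil j)) :
    Measurable (ξhat k) := by
  induction k with
  | zero => exact h0
  | succ k ih =>
    have h1 := ih fun j hj => hy j (hj.trans k.lt_succ_self)
    have h2 := hy k k.lt_succ_self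
    rw [show ξhat (k + 1) = _ from funext (h k)]
    exact (((measurable_mulVec W.Aξ).comp h1).add_const _).add
      ((measurable_mulVec K).comp (h2.sub ((measurable_mulVec W.Cξ).comp h1)))

/-- The output at time `k` depends on `ε` only up to index `k + s`. -/
lemma measurable_output {d : ℕ → Fin p → ℝ}
    (h : ∀ k ω, ξ (k + 1) ω = W.Aξ *ᵥ ξ k ω + W.Bξ *ᵥ u k + W.Gξ *ᵥ ε (k + s + 1) ω)
    (hout : ∀ k ω, ytil k ω = W.Cξ *ᵥ ξ k ω + v k ω) (hy : ∀ k ω, y k ω = ytil k ω + d k)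
    (h0 : Measurable (ξ 0)) {k : ℕ} (hε : ∀ j < k, Measurable (ε (j + s + 1)))
    (hv : ∀ j ≤ k, Measurable (v j)) : Measurable (ytil k) ∧ Measurable (y k) := by
  have h1 : Measurable (ytil k) := by
    rw [show ytil k = _ from funext (hout k)]
    exact ((measurable_mulVec W.Cξ).comp (measurable_augmented h h0 hε)).add (hv k le_rfl)
  refine ⟨h1, ?_⟩
  rw [show y k = _ from funext (hy k)]
  exact h1.add_const _

lemma measurable_predicted_output {K : Matrix W.AugIdx (Fin p) ℝ} {d : ℕ → Fin p → ℝ}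
    (h : ∀ k ω, ξhat (k + 1) ω = W.Aξ *ᵥ ξhat k ω + W.Bξ *ᵥ u k +
      K *ᵥ (ytil k ω - W.Cξ *ᵥ ξhat k ω))
    (hy : ∀ k ω, y k ω = ytil k ω + d k) (hyhat : ∀ k ω, yhat k ω = W.Cξ *ᵥ ξhat k ω + d k)
    (h0 : Measurable (ξhat 0)) {k : ℕ} (hym : ∀ j < k, Measurable (y j)) :
    Measurable (yhat k) := by
  have h1 : ∀ j < k, Measurable (ytil j) := fun j hj => by
    rw [show ytil j = fun ω => y j ω - d j from funext fun ω => by rw [hy, add_sub_cancel_right]]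
    exact (hym j hj).sub_const _
  rw [show yhat k = _ from funext (hyhat k)]
  exact ((measurable_mulVec W.Cξ).comp (measurable_prediction h h0 h1)).add_const _

lemma IsSteadyStateFilter.measurable_yhat
    (hf : IsSteadyStateFilter W u F μ Pinf ε v ξ ytil ξhat)
    (hy : ∀ k ω, y k ω = ytil k ω + W.feedthrough u k)
    (hyhat : ∀ k ω, yhat k ω = W.Cξ *ᵥ ξhat k ω + W.feedthrough u k) (k : ℕ) :
    Measurable[observed F y k] (yhat k) :=
  @measurable_predicted_output n m p ns nf s rw S W u Ω (observed F y k) ytil ξhat y yhat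
    _ _ hf.update hy hyhat (hf.measurable_hat.mono le_sup_left le_rfl) k
    fun _ hj => measurable_observed F y hj

/-- The noise entering at time `k` is independent of the past outputs and of the current
prediction error. -/
lemma IsSteadyStateFilter.indep_noise_observed [IsProbabilityMeasure μ]
    (h : IsAugmentedProcess W u μ ε v ξ ytil)
    (hf : IsSteadyStateFilter W u F μ Pinf ε v ξ ytil ξhat)
    (hy : ∀ k ω, y k ω = ytil k ω + W.feedthrough u k) (k : ℕ) :
    Indep (observed F y k ⊔ MeasurableSpace.comap (fun ω => ξ k ω - ξhat k ω) inferInstance)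
      (MeasurableSpace.comap (fun ω => (ε (k + s + 1) ω, v k ω)) inferInstance) μ := by
  have hε : IsGaussianWhiteNoise 1 (fun k => ε (k + s + 1)) μ := h.white_ε.shift (s + 1)
  have hεv : IndepFun (fun ω k => ε (k + s + 1) ω) (fun ω k => v k ω) μ :=
    h.indep_noise.comp (φ := fun f k => f (k + s + 1)) (ψ := id)
      (measurable_pi_lambda _ fun k => measurable_pi_apply _) measurable_id
  have mε := (measurable_pi_iff.2 hε.measurable : Measurable fun ω k => ε (k + s + 1) ω).comap_le
  have mv := (measurable_pi_iff.2 h.white_v.measurable : Measurable fun ω k => v k ω).comap_le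
  have hεk := comap_le_comap_pi (fun k => ε (k + s + 1)) k
  have hvk := comap_le_comap_pi v k
  have hεp := iSup_comap_le_comap_pi (fun k => ε (k + s + 1)) k
  have hvp := iSup_comap_le_comap_pi v k
  have key := indep_sup_of_indep_sup (sup_le (hεk.trans mε) (hvk.trans mv))
    (sup_le (hεp.trans mε) (hvp.trans mv))
    (sup_le hf.le h.measurable_init.comap_le) (hε.indep_pair h.white_v hεv k)
    (indep_of_indep_of_le_left hf.indep_noise.symm ?_)
  swap
  · exact (sup_le (sup_le_sup hεk hvk) (sup_le_sup hεp hvp)).trans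
      (MeasurableSpace.comap_prodMk _ _).ge
  refine indep_of_indep_of_le key.symm ?_ (MeasurableSpace.comap_prodMk _ _).le
  have aε : ∀ j < k, MeasurableSpace.comap (ε (j + s + 1)) inferInstance ≤
      ((⨆ j : Fin k, MeasurableSpace.comap (ε (j + s + 1)) inferInstance) ⊔
        ⨆ j : Fin k, MeasurableSpace.comap (v j) inferInstance) ⊔
        (F ⊔ MeasurableSpace.comap (ξ 0) inferInstance) := fun j hj =>
    le_sup_of_le_left (le_sup_of_le_left (le_iSup (fun j : Fin k =>
      MeasurableSpace.comap (ε (j + s + 1)) inferInstance) ⟨j, hj⟩))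
  have av : ∀ j < k, MeasurableSpace.comap (v j) inferInstance ≤
      ((⨆ j : Fin k, MeasurableSpace.comap (ε (j + s + 1)) inferInstance) ⊔
        ⨆ j : Fin k, MeasurableSpace.comap (v j) inferInstance) ⊔
        (F ⊔ MeasurableSpace.comap (ξ 0) inferInstance) := fun j hj =>
    le_sup_of_le_left (le_sup_of_le_right (le_iSup (fun j : Fin k =>
      MeasurableSpace.comap (v j) inferInstance) ⟨j, hj⟩))
  have aF : F ≤ ((⨆ j : Fin k, MeasurableSpace.comap (ε (j + s + 1)) inferInstance) ⊔
        ⨆ j : Fin k, MeasurableSpace.comap (v j) inferInstance) ⊔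
        (F ⊔ MeasurableSpace.comap (ξ 0) inferInstance) := le_sup_of_le_right le_sup_left
  have aξ : MeasurableSpace.comap (ξ 0) inferInstance ≤
      ((⨆ j : Fin k, MeasurableSpace.comap (ε (j + s + 1)) inferInstance) ⊔
        ⨆ j : Fin k, MeasurableSpace.comap (v j) inferInstance) ⊔
        (F ⊔ MeasurableSpace.comap (ξ 0) inferInstance) := le_sup_of_le_right le_sup_right
  have hst := h.state_eq
  have hoe := h.output_eq
  have hup := hf.update
  have hmh := hf.measurable_hat
  generalize ((⨆ j : Fin k, MeasurableSpace.comap (ε (j + s + 1)) inferInstance) ⊔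
        ⨆ j : Fin k, MeasurableSpace.comap (v j) inferInstance) ⊔
        (F ⊔ MeasurableSpace.comap (ξ 0) inferInstance) = H at aε av aF aξ ⊢
  have hout : ∀ j < k, Measurable[H] (ytil j) ∧ Measurable[H] (y j) := fun j hj =>
    @measurable_output n m p ns nf s rw S W u Ω H ε v ξ ytil y _ hst hoe hy
      (measurable_iff_comap_le.2 aξ) j
      (fun i hi => measurable_iff_comap_le.2 (aε i (hi.trans hj)))
      (fun i hi => measurable_iff_comap_le.2 (av i (hi.trans_lt hj)))
  have hξ : Measurable[H] (ξ k) :=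
    @measurable_augmented n m p ns nf s rw S W u Ω H ε ξ hst
      (measurable_iff_comap_le.2 aξ) k (fun i hi => measurable_iff_comap_le.2 (aε i hi))
  have hξhat : Measurable[H] (ξhat k) :=
    @measurable_prediction n m p ns nf s rw S W u Ω H ytil ξhat _ hup
      (hmh.mono aF le_rfl) k fun j hj => (hout j hj).1
  refine sup_le (sup_le aF (iSup_le fun j => (hout j j.2).2.comap_le)) ?_
  exact Measurable.comap_le (hξ.sub hξhat)

/-- The prediction error in steady state has distribution `N(0, Pinf)` and is independent of the
information on which the prediction is based; the innovation is independent of it, too. -/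
lemma IsSteadyStateFilter.error_law [IsProbabilityMeasure μ]
    (h : IsAugmentedProcess W u μ ε v ξ ytil)
    (hf : IsSteadyStateFilter W u F μ Pinf ε v ξ ytil ξhat)
    (hy : ∀ k ω, y k ω = ytil k ω + W.feedthrough u k)
    (hyhat : ∀ k ω, yhat k ω = W.Cξ *ᵥ ξhat k ω + W.feedthrough u k)
    (he : ∀ k ω, e k ω = y k ω - yhat k ω) (k : ℕ) :
    HasLaw (fun ω => ξ k ω - ξhat k ω) (centredGaussian Pinf) μ ∧
      HasLaw (e k) (centredGaussian (W.Cξ * Pinf * W.Cξᵀ + S.R)) μ ∧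
      Indep (observed F y k) (MeasurableSpace.comap (e k) inferInstance) μ := by
  have mξ : ∀ k, Measurable (ξ k) := fun k => measurable_augmented h.state_eq h.measurable_init
    fun j _ => h.white_ε.measurable _
  have my : ∀ k, Measurable (ytil k) ∧ Measurable (y k) := fun k =>
    measurable_output h.state_eq h.output_eq hy h.measurable_init
      (fun j _ => h.white_ε.measurable _) fun j _ => h.white_v.measurable _
  have mξhat : ∀ k, Measurable (ξhat k) := fun k =>
    measurable_prediction hf.update (hf.measurable_hat.mono hf.le le_rfl) fun j _ => (my j).1
  have hobs : ∀ k, observed F y k ≤ mΩ := fun k =>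
    sup_le hf.le (iSup_le fun j => (my j).2.comap_le)
  have heq : ∀ k ω, e k ω = W.Cξ *ᵥ (ξ k ω - ξhat k ω) + v k ω := by
    intro k ω
    rw [he, hy, hyhat, h.output_eq, Matrix.mulVec_sub]
    abel
  have herr : ∀ k ω, ξ (k + 1) ω - ξhat (k + 1) ω = W.Aξ *ᵥ (ξ k ω - ξhat k ω) +
      W.Gξ *ᵥ ε (k + s + 1) ω - kalmanGain W.Aξ W.Cξ S.R Pinf *ᵥ e k ω := by
    intro k ω
    have : ytil k ω - W.Cξ *ᵥ ξhat k ω = e k ω := by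
      rw [he, hy, hyhat]
      abel
    rw [h.state_eq, hf.update, this, Matrix.mulVec_sub]
    abel
  have step : ∀ k, HasLaw (fun ω => ξ k ω - ξhat k ω) (centredGaussian Pinf) μ →
      Indep (observed F y k) (MeasurableSpace.comap (fun ω => ξ k ω - ξhat k ω) inferInstance) μ →
      _ := fun k hl hi =>
    innovation_step S.posDef_R hf.steady (hobs k) ((mξ k).sub (mξhat k))
      (h.white_ε.measurable (k + s + 1)) (h.white_v.measurable k) hl (h.white_ε.hasLaw _)
      (h.white_v.hasLaw k)
      (h.indep_noise.comp (measurable_pi_apply (k + s + 1)) (measurable_pi_apply k)) hi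
      (hf.indep_noise_observed h hy k) (heq k) (herr k)
  have main : HasLaw (fun ω => ξ k ω - ξhat k ω) (centredGaussian Pinf) μ ∧
      Indep (observed F y k)
        (MeasurableSpace.comap (fun ω => ξ k ω - ξhat k ω) inferInstance) μ := by
    induction k with
    | zero => exact ⟨hf.law_error, by simpa [observed] using hf.indep_error⟩
    | succ k ih =>
      obtain ⟨h1, -, -, h4⟩ := step k ih.1 ih.2
      refine ⟨h1, indep_of_indep_of_le_left h4 ?_⟩
      rw [observed_succ]
      refine sup_le le_sup_left ?_
      have hyh := hf.measurable_yhat hy hyhat k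
      rw [show y k = fun ω => e k ω + yhat k ω from funext fun ω => by rw [he, sub_add_cancel]]
      exact Measurable.comap_le (Measurable.add (measurable_iff_comap_le.2 le_sup_right)
        (hyh.mono le_sup_left le_rfl))
  obtain ⟨-, h2, h3, -⟩ := step k main.1 main.2
  exact ⟨main.1, h2, h3⟩

end SteadyStateFilter

/-! ### Innovations and conditional expectations -/

section Prediction

variable {n m p ns nf s rw : ℕ} {S : DescriptorSystem n m p} {W : QuasiWeierstrass S ns nf s rw}
  {u : ℕ → Fin m → ℝ} {Ω : Type*} {F : MeasurableSpace Ω} [mΩ : MeasurableSpace Ω] {μ : Measure Ω}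
  {Pinf : Matrix W.AugIdx W.AugIdx ℝ} {ε : ℕ → Ω → Fin rw → ℝ} {v : ℕ → Ω → Fin p → ℝ}
  {ξ : ℕ → Ω → W.AugIdx → ℝ} {ytil : ℕ → Ω → Fin p → ℝ} {ξhat : ℕ → Ω → W.AugIdx → ℝ}
  {y yhat e : ℕ → Ω → Fin p → ℝ}

lemma integrable_mulVec {ι κ : Type*} [Fintype ι] [Fintype κ] {X : Ω → ι → ℝ}
    (M : Matrix κ ι ℝ) (hX : Integrable X μ) : Integrable (fun ω => M *ᵥ X ω) μ :=
  (LinearMap.toContinuousLinearMap M.mulVecLin).integrable_comp hX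

lemma IsSteadyStateFilter.observed_le
    (h : IsAugmentedProcess W u μ ε v ξ ytil)
    (hf : IsSteadyStateFilter W u F μ Pinf ε v ξ ytil ξhat)
    (hy : ∀ k ω, y k ω = ytil k ω + W.feedthrough u k) (k : ℕ) : observed F y k ≤ mΩ :=
  sup_le hf.le (iSup_le fun _ => (measurable_output h.state_eq h.output_eq hy h.measurable_init
    (fun _ _ => h.white_ε.measurable _) fun _ _ => h.white_v.measurable _).2.comap_le)

/-- The innovations of the steady-state Kalman filter are a Gaussian white noise. -/
lemma IsSteadyStateFilter.isGaussianWhiteNoise_innovation [IsProbabilityMeasure μ]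
    (h : IsAugmentedProcess W u μ ε v ξ ytil)
    (hf : IsSteadyStateFilter W u F μ Pinf ε v ξ ytil ξhat)
    (hy : ∀ k ω, y k ω = ytil k ω + W.feedthrough u k)
    (hyhat : ∀ k ω, yhat k ω = W.Cξ *ᵥ ξhat k ω + W.feedthrough u k)
    (he : ∀ k ω, e k ω = y k ω - yhat k ω) :
    IsGaussianWhiteNoise (W.Cξ * Pinf * W.Cξᵀ + S.R) e μ := by
  have hem : ∀ j k, j < k → Measurable[observed F y k] (e j) := by
    intro j k hjk
    rw [show e j = _ from funext (he j)]
    exact (measurable_observed F y hjk).sub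
      ((hf.measurable_yhat hy hyhat j).mono (observed_mono F y hjk.le) le_rfl)
  exact ⟨fun k => (hem k (k + 1) k.lt_succ_self).mono (hf.observed_le h hy _) le_rfl,
    fun k => (hf.error_law h hy hyhat he k).2.1,
    iIndepFun_of_indep_past (observed F y) hem fun k => (hf.error_law h hy hyhat he k).2.2⟩

/-- The predicted output is the conditional expectation of the output. -/
lemma IsSteadyStateFilter.yhat_eq_condExp [IsProbabilityMeasure μ]
    (h : IsAugmentedProcess W u μ ε v ξ ytil)
    (hf : IsSteadyStateFilter W u F μ Pinf ε v ξ ytil ξhat)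
    (hy : ∀ k ω, y k ω = ytil k ω + W.feedthrough u k)
    (hyhat : ∀ k ω, yhat k ω = W.Cξ *ᵥ ξhat k ω + W.feedthrough u k)
    (he : ∀ k ω, e k ω = y k ω - yhat k ω) (hint : Integrable (ξhat 0) μ) (k : ℕ) :
    yhat k =ᵐ[μ] μ[y k | observed F y k] := by
  have hw := hf.isGaussianWhiteNoise_innovation h hy hyhat he
  have hei : ∀ k, Integrable (e k) μ := fun k =>
    integrable_of_hasLaw_centredGaussian (hw.hasLaw k)
  have hξi : Integrable (ξhat k) μ := by
    induction k with
    | zero => exact hint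
    | succ k ih =>
      have : ∀ ω, ytil k ω - W.Cξ *ᵥ ξhat k ω = e k ω := by
        intro ω
        rw [he, hy, hyhat]
        abel
      rw [show ξhat (k + 1) = _ from funext (hf.update k)]
      simp only [this]
      exact ((integrable_mulVec _ ih).add (integrable_const _)).add (integrable_mulVec _ (hei k))
  have hyi : Integrable (yhat k) μ := by
    rw [show yhat k = _ from funext (hyhat k)]
    exact (integrable_mulVec _ hξi).add (integrable_const _)
  have hsum : y k = yhat k + e k := funext fun ω => by
    rw [Pi.add_apply, he, add_sub_cancel]
  have hle := hf.observed_le h hy k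
  have h1 : μ[yhat k | observed F y k] = yhat k :=
    condExp_of_stronglyMeasurable hle (hf.measurable_yhat hy hyhat k).stronglyMeasurable hyi
  have h2 : μ[e k | observed F y k] =ᵐ[μ] fun _ => ∫ ω, e k ω ∂μ :=
    condExp_indep_eq (hw.measurable k).comap_le hle
      (comap_measurable (e k)).stronglyMeasurable (hf.error_law h hy hyhat he k).2.2.symm
  have h3 := condExp_add hyi (hei k) (observed F y k)
  rw [← hsum, h1] at h3
  rw [integral_of_hasLaw_centredGaussian (hw.hasLaw k)] at h2
  filter_upwards [h2, h3] with ω h2 h3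
  rw [h3, Pi.add_apply, h2, add_zero]

end Prediction

/-! ### The descriptor system and its outputs -/

section Descriptor

variable {n m p ns nf s rw : ℕ} {S : DescriptorSystem n m p} (W : QuasiWeierstrass S ns nf s rw)

/-- The fast part of a descriptor state `x`, i.e. the last `nf` coordinates of `T⁻¹ x`. -/
def fastState (x : Fin n → ℝ) : Fin nf → ℝ := fun i => (W.T⁻¹ *ᵥ x) (W.fastIdx i)

lemma blockEquiv_funext_iff (f g : Fin n → ℝ) :
    f = g ↔ (fun i => f (W.slowIdx i)) = (fun i => g (W.slowIdx i)) ∧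
      (fun i => f (W.fastIdx i)) = fun i => g (W.fastIdx i) := by
  refine ⟨by rintro rfl; simp, fun h => funext fun j => ?_⟩
  obtain ⟨i, rfl⟩ := (blockEquiv W.dim).surjective j
  rcases i with i | i
  · exact congrFun h.1 i
  · exact congrFun h.2 i

lemma mulVec_T_inv (x : Fin n → ℝ) : W.T *ᵥ (W.T⁻¹ *ᵥ x) = x := by
  rw [Matrix.mulVec_mulVec, Matrix.mul_nonsing_inv _ W.isUnit_T, Matrix.one_mulVec]

lemma reindex_fromBlocks_mulVec (X : Matrix (Fin ns) (Fin ns) ℝ) (Y : Matrix (Fin nf) (Fin nf) ℝ)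
    (z : Fin n → ℝ) :
    ((Matrix.fromBlocks X 0 0 Y).reindex (blockEquiv W.dim) (blockEquiv W.dim) *ᵥ z) ∘
      blockEquiv W.dim =
    Sum.elim (X *ᵥ fun i => z (W.slowIdx i)) (Y *ᵥ fun i => z (W.fastIdx i)) := by
  rw [Matrix.reindex_apply, Matrix.submatrix_mulVec_equiv, Function.comp_assoc,
    Equiv.symm_comp_self, Function.comp_id, Equiv.symm_symm,
    ← Sum.elim_comp_inl_inr (z ∘ blockEquiv W.dim), Matrix.fromBlocks_mulVec]
  simp only [Matrix.zero_mulVec, add_zero, zero_add]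
  rfl

/-- One step of the descriptor equation, decoupled into its slow and its fast part. -/
lemma descriptor_step_iff (x x' w : Fin n → ℝ) (b : Fin m → ℝ) :
    S.E *ᵥ x' = S.A *ᵥ x + S.B *ᵥ b + w ↔
      W.slowState x' = W.J *ᵥ W.slowState x + W.Bs *ᵥ b + (fun i => (W.P *ᵥ w) (W.slowIdx i)) ∧
      W.N *ᵥ fastState W x' = fastState W x + W.Bf *ᵥ b +
        fun i => (W.P *ᵥ w) (W.fastIdx i) := by
  have hP : Function.Injective (W.P.mulVec) :=
    Matrix.mulVec_injective_iff_isUnit.2 ((Matrix.isUnit_iff_isUnit_det _).2 W.isUnit_P)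
  have hE : W.P *ᵥ (S.E *ᵥ x') = (W.P * S.E * W.T) *ᵥ (W.T⁻¹ *ᵥ x') := by
    rw [← Matrix.mulVec_mulVec, mulVec_T_inv, Matrix.mulVec_mulVec]
  have hA : W.P *ᵥ (S.A *ᵥ x) = (W.P * S.A * W.T) *ᵥ (W.T⁻¹ *ᵥ x) := by
    rw [← Matrix.mulVec_mulVec, mulVec_T_inv, Matrix.mulVec_mulVec]
  have hE' := reindex_fromBlocks_mulVec W 1 W.N (W.T⁻¹ *ᵥ x')
  have hA' := reindex_fromBlocks_mulVec W W.J 1 (W.T⁻¹ *ᵥ x)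
  rw [← W.transform_E, ← hE, Matrix.one_mulVec] at hE'
  rw [← W.transform_A, ← hA, Matrix.one_mulVec] at hA'
  have hEs : (fun i => (W.P *ᵥ (S.E *ᵥ x')) (W.slowIdx i)) = W.slowState x' :=
    funext fun i => congrFun hE' (Sum.inl i)
  have hEf : (fun i => (W.P *ᵥ (S.E *ᵥ x')) (W.fastIdx i)) = W.N *ᵥ fastState W x' :=
    funext fun i => congrFun hE' (Sum.inr i)
  have hAs : (fun i => (W.P *ᵥ (S.A *ᵥ x)) (W.slowIdx i)) = W.J *ᵥ W.slowState x :=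
    funext fun i => congrFun hA' (Sum.inl i)
  have hAf : (fun i => (W.P *ᵥ (S.A *ᵥ x)) (W.fastIdx i)) = fastState W x :=
    funext fun i => congrFun hA' (Sum.inr i)
  have hBs : (fun i => (W.P *ᵥ (S.B *ᵥ b)) (W.slowIdx i)) = W.Bs *ᵥ b := by
    rw [Matrix.mulVec_mulVec]; rfl
  have hBf : (fun i => (W.P *ᵥ (S.B *ᵥ b)) (W.fastIdx i)) = W.Bf *ᵥ b := by
    rw [Matrix.mulVec_mulVec]; rfl
  rw [← hP.eq_iff, blockEquiv_funext_iff W, hEs, hEf, Matrix.mulVec_add, Matrix.mulVec_add,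
    ← hAs, ← hAf, ← hBs, ← hBf]
  rfl

lemma output_mulVec (x : Fin n → ℝ) :
    S.C *ᵥ x = W.Cs *ᵥ W.slowState x + W.Cf *ᵥ fastState W x := by
  conv_lhs => rw [← mulVec_T_inv W x, Matrix.mulVec_mulVec]
  funext i
  simp only [Matrix.mulVec, dotProduct, Pi.add_apply]
  rw [← (blockEquiv W.dim).sum_comp, Fintype.sum_sum_type]
  rfl

/-- Since `N` is nilpotent, the fast equation `N z (k+1) = z k + f k` has exactly one solution. -/
lemma fast_solution_iff (z f : ℕ → Fin nf → ℝ) :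
    (∀ k, W.N *ᵥ z (k + 1) = z k + f k) ↔
      ∀ k, z k = -∑ i ∈ Finset.range s, (W.N ^ i) *ᵥ f (k + i) := by
  constructor
  · intro h k
    have hj : ∀ j, z k = (W.N ^ j) *ᵥ z (k + j) -
        ∑ i ∈ Finset.range j, (W.N ^ i) *ᵥ f (k + i) := by
      intro j
      induction j with
      | zero => simp
      | succ j ih =>
        have := h (k + j)
        rw [Finset.sum_range_succ, pow_succ, ← Matrix.mulVec_mulVec, ← add_assoc k j 1, this,
          Matrix.mulVec_add]
        rw [ih]
        abel
    rw [hj s, N_pow_eq_zero, Matrix.zero_mulVec, zero_sub]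
  · intro h k
    have h1 : ∑ i ∈ Finset.range (s + 1), (W.N ^ i) *ᵥ f (k + i) =
        ∑ i ∈ Finset.range s, (W.N ^ i) *ᵥ f (k + i) := by
      rw [Finset.sum_range_succ, N_pow_eq_zero, Matrix.zero_mulVec, add_zero]
    rw [h k, h (k + 1), ← h1, Finset.sum_range_succ', Matrix.mulVec_neg, Matrix.mulVec_sum]
    simp only [Matrix.mulVec_mulVec, ← pow_succ', pow_zero, Matrix.one_mulVec, add_zero,
      add_right_comm k 1, add_assoc k _ 1]
    abel

/-- The slow states driven by the transformed noise `w`. -/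
def slowTrajectory (u : ℕ → Fin m → ℝ) (x₀ : Fin ns → ℝ) (w : ℕ → Fin n → ℝ) : ℕ → Fin ns → ℝ
  | 0 => x₀
  | k + 1 => W.J *ᵥ slowTrajectory u x₀ w k + W.Bs *ᵥ u k + fun i => w k (W.slowIdx i)

/-- The output sequence as a function of the initial slow state, the transformed process noise
and the measurement noise. -/
def outputMap (u : ℕ → Fin m → ℝ)
    (z : (Fin ns → ℝ) × (ℕ → Fin n → ℝ) × (ℕ → Fin p → ℝ)) (k : ℕ) : Fin p → ℝ :=
  W.Cs *ᵥ slowTrajectory W u z.1 z.2.1 k -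
    W.Cf *ᵥ ∑ i ∈ Finset.range s, (W.N ^ i) *ᵥ (fun a => z.2.1 (k + i) (W.fastIdx a)) +
    z.2.2 k + W.feedthrough u k

lemma measurable_outputMap (u : ℕ → Fin m → ℝ) : Measurable (outputMap W u) := by
  have hw : ∀ {r : ℕ} (g : Fin r → Fin n) (j : ℕ), Measurable
      fun z : (Fin ns → ℝ) × (ℕ → Fin n → ℝ) × (ℕ → Fin p → ℝ) => fun i => z.2.1 j (g i) := by
    intro r g j
    fun_prop
  have hs : ∀ k, Measurable fun z : (Fin ns → ℝ) × (ℕ → Fin n → ℝ) × (ℕ → Fin p → ℝ) =>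
      slowTrajectory W u z.1 z.2.1 k := by
    intro k
    induction k with
    | zero => exact measurable_fst
    | succ k ih =>
      exact (((measurable_mulVec W.J).comp ih).add_const _).add (hw W.slowIdx k)
  refine measurable_pi_lambda _ fun k => ?_
  refine ((((measurable_mulVec W.Cs).comp (hs k)).sub ((measurable_mulVec W.Cf).comp
    (Finset.measurable_fun_sum _ fun i _ =>
      (measurable_mulVec _).comp (hw W.fastIdx _)))).add ?_).add_const _
  fun_prop

variable {W} {u : ℕ → Fin m → ℝ} {μ₀ : Measure (Fin ns → ℝ)} {Ω : Type*} [MeasurableSpace Ω]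
  {μ : Measure Ω}

lemma feedthrough_eq (k : ℕ) (f : ℕ → Fin nf → ℝ) (c : Fin p → ℝ) :
    c + W.Cf *ᵥ (-∑ i ∈ Finset.range s, (W.N ^ i) *ᵥ (W.Bf *ᵥ u (k + i) + f (k + i))) +
        S.D *ᵥ u k =
      c - W.Cf *ᵥ ∑ i ∈ Finset.range s, (W.N ^ i) *ᵥ f (k + i) + W.feedthrough u k := by
  simp only [QuasiWeierstrass.feedthrough, Matrix.mulVec_add, Finset.sum_add_distrib,
    Matrix.mulVec_neg, Matrix.mulVec_mulVec]
  abel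

lemma IsDescriptorProcess.output_eq_outputMap {x w : ℕ → Ω → Fin n → ℝ}
    {v y : ℕ → Ω → Fin p → ℝ} (h : IsDescriptorProcess W u μ₀ μ x w v y) (ω : Ω) :
    (fun k => y k ω) = outputMap W u
      (W.slowState (x 0 ω), (fun k => W.P *ᵥ w k ω), fun k => v k ω) := by
  have hstep := fun k => (descriptor_step_iff W _ _ _ _).1 (h.state_eq k ω)
  have hs : ∀ k, W.slowState (x k ω) =
      slowTrajectory W u (W.slowState (x 0 ω)) (fun k => W.P *ᵥ w k ω) k := by
    intro k
    induction k with
    | zero => rfl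
    | succ k ih => rw [(hstep k).1, ih]; rfl
  have hf := (fast_solution_iff W (fun k => fastState W (x k ω))
    (fun k => W.Bf *ᵥ u k + fun i => (W.P *ᵥ w k ω) (W.fastIdx i))).1 fun k => by
      rw [(hstep k).2, add_assoc]
  funext k
  have := feedthrough_eq (W := W) (u := u) k (fun k i => (W.P *ᵥ w k ω) (W.fastIdx i))
    (W.Cs *ᵥ W.slowState (x k ω))
  rw [h.output_eq, output_mulVec W, hf k, this, hs k]
  simp only [outputMap]
  abel

lemma IsAugmentedProcess.output_eq_outputMap {ε : ℕ → Ω → Fin rw → ℝ} {v : ℕ → Ω → Fin p → ℝ}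
    {ξ : ℕ → Ω → W.AugIdx → ℝ} {ytil : ℕ → Ω → Fin p → ℝ}
    (h : IsAugmentedProcess W u μ ε v ξ ytil) (h0 : HasBufferedInit W μ₀ μ ε v ξ) (ω : Ω) :
    (fun k => ytil k ω + W.feedthrough u k) = outputMap W u
      ((fun i => ξ 0 ω (Sum.inl i)), (fun k => W.L *ᵥ ε k ω), fun k => v k ω) := by
  have hs : ∀ k, (fun i => ξ k ω (Sum.inl i)) =
      slowTrajectory W u (fun i => ξ 0 ω (Sum.inl i)) (fun k => W.L *ᵥ ε k ω) k := by
    intro k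
    induction k with
    | zero => rfl
    | succ k ih => rw [h.slow_eq h0, ih]; rfl
  funext k
  rw [h.output_eq_sum h0, hs k]
  rfl

/-- The joint law of an initial value and two white noises, all independent. -/
lemma hasLaw_init_noise {α ι κ : Type*} [MeasurableSpace α] [Fintype ι] [DecidableEq ι]
    [Fintype κ] [DecidableEq κ] [IsProbabilityMeasure μ] {μ₀ : Measure α} {V : Matrix ι ι ℝ}
    {V' : Matrix κ κ ℝ} {x₀ : Ω → α} {w : ℕ → Ω → ι → ℝ} {v : ℕ → Ω → κ → ℝ}
    (hx : HasLaw x₀ μ₀ μ) (hw : IsGaussianWhiteNoise V w μ) (hv : IsGaussianWhiteNoise V' v μ)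
    (hwv : IndepFun (fun ω k => w k ω) (fun ω k => v k ω) μ)
    (hxn : IndepFun x₀ (fun ω => ((fun k => w k ω), fun k => v k ω)) μ) :
    HasLaw (fun ω => (x₀ ω, (fun k => w k ω), fun k => v k ω))
      (μ₀.prod ((Measure.infinitePi fun _ => centredGaussian V).prod
        (Measure.infinitePi fun _ => centredGaussian V'))) μ := by
  have h1 := hw.indep.hasLaw_infinitePi hw.hasLaw (measurable_pi_iff.2 hw.measurable).aemeasurable
  have h2 := hv.indep.hasLaw_infinitePi hv.hasLaw (measurable_pi_iff.2 hv.measurable).aemeasurable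
  exact hxn.hasLaw_prod hx (hwv.hasLaw_prod h1 h2)

lemma IsGaussianWhiteNoise.mulVec {ι κ : Type*} [Fintype ι] [DecidableEq ι] [Fintype κ]
    [DecidableEq κ] {V : Matrix ι ι ℝ} {X : ℕ → Ω → ι → ℝ} (h : IsGaussianWhiteNoise V X μ)
    (hV : V.PosSemidef) (M : Matrix κ ι ℝ) :
    IsGaussianWhiteNoise (M * V * Mᵀ) (fun k ω => M *ᵥ X k ω) μ where
  measurable k := (measurable_mulVec M).comp (h.measurable k)
  hasLaw k := hasLaw_mulVec_centredGaussian hV (h.hasLaw k) M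
  indep := h.indep.comp (fun _ x => M *ᵥ x) fun _ => measurable_mulVec M

/-- The transformed process noise of the descriptor system and `L ε` have the same covariance, so
that the outputs are images of equally distributed data under the same map. -/
lemma map_output_eq {Ω' : Type*} [MeasurableSpace Ω'] [IsProbabilityMeasure μ] {μ' : Measure Ω'}
    [IsProbabilityMeasure μ'] {x w : ℕ → Ω → Fin n → ℝ} {v y : ℕ → Ω → Fin p → ℝ}
    {ε : ℕ → Ω' → Fin rw → ℝ} {v' : ℕ → Ω' → Fin p → ℝ} {ξ : ℕ → Ω' → W.AugIdx → ℝ}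
    {ytil : ℕ → Ω' → Fin p → ℝ} (h : IsDescriptorProcess W u μ₀ μ x w v y)
    (h' : IsAugmentedProcess W u μ' ε v' ξ ytil) (h0 : HasBufferedInit W μ₀ μ' ε v' ξ) :
    μ.map (fun ω k => y k ω) = μ'.map (fun ω k => ytil k ω + W.feedthrough u k) := by
  have mpi : ∀ {a b : ℕ} (M : Matrix (Fin b) (Fin a) ℝ),
      Measurable fun f : ℕ → Fin a → ℝ => fun k => M *ᵥ f k := fun M =>
    measurable_pi_lambda _ fun k => (measurable_mulVec M).comp (measurable_pi_apply k)
  have hw := h.white_w.mulVec S.posSemidef_Q W.P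
  have hε := h'.white_ε.mulVec Matrix.PosSemidef.one W.L
  rw [← W.factor_noise] at hw
  rw [Matrix.mul_one] at hε
  have l1 := hasLaw_init_noise h.law_init hw h.white_v
    (h.indep_noise.comp (mpi W.P) measurable_id)
    (h.indep_init.comp measurable_id ((mpi W.P).prodMap measurable_id))
  have l2 := hasLaw_init_noise h0.law_init hε h'.white_v
    (h'.indep_noise.comp (mpi W.L) measurable_id)
    (h0.indep_init.comp measurable_id ((mpi W.L).prodMap measurable_id))
  have hm := measurable_outputMap W u
  rw [show (fun ω k => y k ω) = _ from funext h.output_eq_outputMap,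
    show (fun ω k => ytil k ω + W.feedthrough u k) = _ from
      funext (h'.output_eq_outputMap h0),
    ← Function.comp_def (outputMap W u), ← AEMeasurable.map_map_of_aemeasurable
      hm.aemeasurable l1.aemeasurable, l1.map_eq,
    ← Function.comp_def (outputMap W u), ← AEMeasurable.map_map_of_aemeasurable
      hm.aemeasurable l2.aemeasurable, l2.map_eq]

variable (W) in
/-- The descriptor state with slow part `a` and fast part `b`. -/
def assembleState (a : Fin ns → ℝ) (b : Fin nf → ℝ) : Fin n → ℝ :=
  W.T *ᵥ (Sum.elim a b ∘ (blockEquiv W.dim).symm)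

lemma T_inv_assembleState (a : Fin ns → ℝ) (b : Fin nf → ℝ) :
    W.T⁻¹ *ᵥ assembleState W a b = Sum.elim a b ∘ (blockEquiv W.dim).symm := by
  rw [assembleState, Matrix.mulVec_mulVec, Matrix.nonsing_inv_mul _ W.isUnit_T, Matrix.one_mulVec]

lemma slowState_assembleState (a : Fin ns → ℝ) (b : Fin nf → ℝ) :
    W.slowState (assembleState W a b) = a := by
  funext i
  simp [QuasiWeierstrass.slowState, T_inv_assembleState, QuasiWeierstrass.slowIdx]

lemma fastState_assembleState (a : Fin ns → ℝ) (b : Fin nf → ℝ) :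
    fastState W (assembleState W a b) = b := by
  funext i
  simp [fastState, T_inv_assembleState, QuasiWeierstrass.fastIdx]

/-- Every process of the augmented system is realized by the descriptor system. -/
lemma exists_isDescriptorProcess {ε : ℕ → Ω → Fin rw → ℝ} {v : ℕ → Ω → Fin p → ℝ}
    {ξ : ℕ → Ω → W.AugIdx → ℝ} {ytil : ℕ → Ω → Fin p → ℝ}
    (h : IsAugmentedProcess W u μ ε v ξ ytil) (h0 : HasBufferedInit W μ₀ μ ε v ξ) :
    ∃ x : ℕ → Ω → Fin n → ℝ,
      IsDescriptorProcess W u μ₀ μ x (fun k ω => W.P⁻¹ *ᵥ (W.L *ᵥ ε k ω)) v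
        (fun k ω => ytil k ω + W.feedthrough u k) ∧
      ∀ k ω, W.slowState (x k ω) = fun i => ξ k ω (Sum.inl i) := by
  let f : Ω → ℕ → Fin nf → ℝ := fun ω k => W.Bf *ᵥ u k + W.Lf *ᵥ ε k ω
  let z : ℕ → Ω → Fin nf → ℝ := fun k ω =>
    -∑ i ∈ Finset.range s, (W.N ^ i) *ᵥ f ω (k + i)
  have hz : ∀ k ω, z k ω = -∑ i ∈ Finset.range s, (W.N ^ i) *ᵥ f ω (k + i) := fun _ _ => rfl
  let x : ℕ → Ω → Fin n → ℝ := fun k ω =>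
    assembleState W (fun i => ξ k ω (Sum.inl i)) (z k ω)
  have hslow : ∀ k ω, W.slowState (x k ω) = fun i => ξ k ω (Sum.inl i) :=
    fun k ω => slowState_assembleState _ _
  have hfast : ∀ k ω, fastState W (x k ω) = z k ω := fun k ω => fastState_assembleState _ _
  have hPw : ∀ k ω, W.P *ᵥ (W.P⁻¹ *ᵥ (W.L *ᵥ ε k ω)) = W.L *ᵥ ε k ω := by
    intro k ω
    rw [Matrix.mulVec_mulVec, Matrix.mul_nonsing_inv _ W.isUnit_P, Matrix.one_mulVec]
  have mξ : ∀ k, Measurable (ξ k) := fun k => measurable_augmented h.state_eq h.measurable_init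
    fun j _ => h.white_ε.measurable _
  have mz : ∀ k, Measurable (z k) := fun k =>
    (Finset.measurable_fun_sum _ fun i _ => (measurable_mulVec _).comp
      (((measurable_mulVec W.Lf).comp (h.white_ε.measurable (k + i))).const_add _)).neg
  have mpi : Measurable fun g : ℕ → Fin rw → ℝ => fun k => W.P⁻¹ *ᵥ (W.L *ᵥ g k) :=
    measurable_pi_lambda _ fun k => (measurable_mulVec _).comp ((measurable_mulVec _).comp
      (measurable_pi_apply k))
  have hcov : W.P⁻¹ * (W.L * W.Lᵀ) * (W.P⁻¹)ᵀ = S.Q := by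
    rw [W.factor_noise, Matrix.mul_assoc W.P, Matrix.nonsing_inv_mul_cancel_left _ _ W.isUnit_P,
      Matrix.mul_assoc, ← Matrix.transpose_mul, Matrix.nonsing_inv_mul _ W.isUnit_P,
      Matrix.transpose_one, Matrix.mul_one]
  have hLε := h.white_ε.mulVec Matrix.PosSemidef.one W.L
  rw [Matrix.mul_one] at hLε
  refine ⟨x, ⟨?_, h.white_v, h.indep_noise.comp mpi measurable_id, fun k => ?_, ?_, ?_,
    fun k ω => ?_, fun k ω => ?_⟩, hslow⟩
  · have := hLε.mulVec (posSemidef_mul_transpose W.L) W.P⁻¹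
    rwa [hcov] at this
  · refine (measurable_mulVec W.T).comp (measurable_pi_lambda _ fun j => ?_)
    rcases hj : (blockEquiv W.dim).symm j with i | i
    · simpa [hj, Function.comp_def] using (measurable_pi_apply (Sum.inl i)).comp (mξ k)
    · simpa [hj, Function.comp_def] using (measurable_pi_apply i).comp (mz k)
  · simpa only [hslow] using h0.law_init
  · simp only [hslow]
    exact h0.indep_init.comp measurable_id (mpi.prodMap measurable_id)
  · rw [descriptor_step_iff W, hPw, hslow, hslow, hfast, hfast]
    refine ⟨h.slow_eq h0 k ω, ?_⟩
    rw [(fast_solution_iff W (fun k => z k ω) (f ω)).2 (fun k => rfl) k, add_assoc]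
    rfl
  · have := feedthrough_eq (W := W) (u := u) k (fun k => W.Lf *ᵥ ε k ω)
      (W.Cs *ᵥ fun i => ξ k ω (Sum.inl i))
    rw [output_mulVec W, hslow, hfast, hz, this, h.output_eq_sum h0]
    abel

end Descriptor

end

/-! ### Stochastic equivalence -/

theorem theorem2 {n m p ns nf s rw : ℕ} (S : DescriptorSystem n m p)
    (W : QuasiWeierstrass S ns nf s rw) (u : ℕ → Fin m → ℝ) :
    -- the augmented state is the slow state with the noise buffer appended, and the
    -- driving noise is independent of the present and past states and of the measurement noise
    (∀ {Ω : Type*} [MeasurableSpace Ω] (μ : Measure Ω) [IsProbabilityMeasure μ]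
        (μ₀ : Measure (Fin ns → ℝ))
        (ε : ℕ → Ω → Fin rw → ℝ) (v : ℕ → Ω → Fin p → ℝ)
        (ξ : ℕ → Ω → W.AugIdx → ℝ) (ytil : ℕ → Ω → Fin p → ℝ),
        IsAugmentedProcess W u μ ε v ξ ytil → HasBufferedInit W μ₀ μ ε v ξ →
        ∀ k,
          (∀ ω i b, ξ k ω (Sum.inr (i, b)) = ε (k + i.val) ω b) ∧
          IndepFun (ε (k + s + 1))
            (fun ω => ((fun j : Fin (k + 1) => ξ j ω), (fun j => v j ω))) μ) ∧
    -- a steady-state Kalman filter exists if the augmented system is detectable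
    (IsDetectable W.Aξ W.Cξ →
      ∃ Pinf, IsSteadyStateCovariance W.Aξ W.Gξ W.Cξ S.R Pinf) ∧
    -- the innovations of the steady-state Kalman filter
    (∀ {Ω : Type*} (F : MeasurableSpace Ω) [MeasurableSpace Ω] (μ : Measure Ω)
        [IsProbabilityMeasure μ] (Pinf : Matrix W.AugIdx W.AugIdx ℝ)
        (ε : ℕ → Ω → Fin rw → ℝ) (v : ℕ → Ω → Fin p → ℝ)
        (ξ : ℕ → Ω → W.AugIdx → ℝ) (ytil : ℕ → Ω → Fin p → ℝ)
        (ξhat : ℕ → Ω → W.AugIdx → ℝ) (y yhat e : ℕ → Ω → Fin p → ℝ),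
        IsAugmentedProcess W u μ ε v ξ ytil →
        IsSteadyStateFilter W u F μ Pinf ε v ξ ytil ξhat →
        (∀ k ω, y k ω = ytil k ω + W.feedthrough u k) →
        (∀ k ω, yhat k ω = W.Cξ *ᵥ ξhat k ω + W.feedthrough u k) →
        (∀ k ω, e k ω = y k ω - yhat k ω) →
        IsGaussianWhiteNoise (W.Cξ * Pinf * W.Cξᵀ + S.R) e μ ∧
        (∀ k, HasLaw (fun ω => ξ k ω - ξhat k ω) (centredGaussian Pinf) μ) ∧
        (Integrable (ξhat 0) μ → ∀ k, yhat k =ᵐ[μ]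
          μ[y k | F ⊔ ⨆ j : Fin k, MeasurableSpace.comap (y j) inferInstance])) ∧
    -- the descriptor system and the augmented system have the same output distributions
    (∀ {Ω Ω' : Type*} [MeasurableSpace Ω] [MeasurableSpace Ω']
        (μ : Measure Ω) [IsProbabilityMeasure μ] (μ' : Measure Ω') [IsProbabilityMeasure μ']
        (μ₀ : Measure (Fin ns → ℝ))
        (x w : ℕ → Ω → Fin n → ℝ) (v y : ℕ → Ω → Fin p → ℝ)
        (ε : ℕ → Ω' → Fin rw → ℝ) (v' : ℕ → Ω' → Fin p → ℝ)
        (ξ : ℕ → Ω' → W.AugIdx → ℝ) (ytil : ℕ → Ω' → Fin p → ℝ),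
        IsDescriptorProcess W u μ₀ μ x w v y →
        IsAugmentedProcess W u μ' ε v' ξ ytil → HasBufferedInit W μ₀ μ' ε v' ξ →
        μ.map (fun ω k => y k ω) = μ'.map (fun ω k => ytil k ω + W.feedthrough u k)) ∧
    -- every process of the augmented system is realized by a process of the descriptor system
    -- with the same noise, the same slow state and the same output
    (∀ {Ω : Type*} [MeasurableSpace Ω] (μ : Measure Ω) [IsProbabilityMeasure μ]
        (μ₀ : Measure (Fin ns → ℝ))
        (ε : ℕ → Ω → Fin rw → ℝ) (v : ℕ → Ω → Fin p → ℝ)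
        (ξ : ℕ → Ω → W.AugIdx → ℝ) (ytil : ℕ → Ω → Fin p → ℝ),
        IsAugmentedProcess W u μ ε v ξ ytil → HasBufferedInit W μ₀ μ ε v ξ →
        ∃ x : ℕ → Ω → Fin n → ℝ,
          IsDescriptorProcess W u μ₀ μ x (fun k ω => W.P⁻¹ *ᵥ (W.L *ᵥ ε k ω)) v
            (fun k ω => ytil k ω + W.feedthrough u k) ∧
          ∀ k ω, W.slowState (x k ω) = fun i => ξ k ω (Sum.inl i)) := by
  refine ⟨?_, exists_isSteadyStateCovariance S.posDef_R, ?_, ?_, ?_⟩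
  · intro Ω _ μ _ μ₀ ε v ξ ytil h h0 k
    exact ⟨h.buffer_eq h0 k, h.indepFun_noise h0 k⟩
  · intro Ω F _ μ _ Pinf ε v ξ ytil ξhat y yhat e h hf hy hyhat he
    exact ⟨hf.isGaussianWhiteNoise_innovation h hy hyhat he,
      fun k => (hf.error_law h hy hyhat he k).1, hf.yhat_eq_condExp h hy hyhat he⟩
  · intro Ω Ω' _ _ μ _ μ' _ μ₀ x w v y ε v' ξ ytil h h' h0
    exact map_output_eq h h' h0
  · intro Ω _ μ _ μ₀ ε v ξ ytil h h0
    exact exists_isDescriptorProcess h h0
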